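/- **Setting.** Let $t_0\ge 0$, $T>0$, $I=[t_0,t_0+T]$, and let $a:I\to\mathbb R$ be continuous with $a\ge\frac32$. For $\bar p\in\mathbb R^3$ put $p^0=p^0(a,\bar p)=\sqrt{1+a^2|\bar p|^2}$. Let $L^1_2(\mathbb R^3)$ be the Banach space of (classes of) measurable functions with $\|u\|=\int_{\mathbb R^3}\sqrt{1+|\bar p|^2}\,|u(\bar p)|\,d\bar p<\infty$, and $X_r=\{u\in L^1_2(\mathbb R^3): u\ge 0 \text{ a.e.},\ \|u\|\le r\}$. For $\omega\in S^2$ (the Euclidean unit sphere) let $\bar p'=\bar p+b\,\omega$, $\bar q'=\bar q-b\,\omega$, where, with $e=p^0+q^0$, $$b=b(\bar p,\bar q,\omega)=\frac{2\,p^0q^0\,e\;\omega\cdot\left(\frac{\bar q}{q^0}-\frac{\bar p}{p^0}\right)}{e^2-a^2\,(\omega\cdot(\bar p+\bar q))^2},$$ so that $\bar p+\bar q=\bar p'+\bar q'$ and $p^0+q^0=p'^0+q'^0$. Let the collision kernel $A(a,\bar p,\bar q,\bar p',\bar q')$, $a>0$, be measurable in the momenta and satisfy, for constants $C_1,\gamma>0$,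 $0\le A\le C_1$, $A(a,\bar p,\bar q,\bar p',\bar q')=A(a,\bar q,\bar p,\bar q',\bar p')=A(a,\bar p',\bar q',\bar p,\bar q)$ and $|A(a_1,\cdot)-A(a_2,\cdot)|\le\gamma|a_1-a_2|$. The collision operator is $$Q(f,f)(\bar p)=\int_{\mathbb R^3}\frac{a^3\,d\bar q}{q^0}\int_{S^2}\big[f(\bar p')f(\bar q')-f(\bar p)f(\bar q)\big]A(a,\bar p,\bar q,\bar p',\bar q')\,d\omega .$$ **Proposition 4.1.** Let $f_{t_0}\in L^1_2(\mathbb R^3)$, $f_{t_0}\ge0$ a.e., $r>\|f_{t_0}\|$, and let $f\in C(I;X_r)$ be a solution of the Boltzmann equation in integral form $$f(t_0+t)=f_{t_0}+\int_{t_0}^{t_0+t}\frac1{p^0}\,Q(f,f)(s)\,ds,\qquad t\in[0,T],$$ an identity in $L^1_2(\mathbb R^3)$, where $a=a(s)$ in $p^0$ and $Q$ at time $s$. Suppose that $f_{t_0}$ is invariant by $SO(3)$ and that $A(a(t),M\bar p,M\bar q,M\bar p',M\bar q')=A(a(t),\bar p,\bar q,\bar p',\bar q')$ for all $t\in I$,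 $M\in SO(3)$ and all momenta. Then: 1. For every $t\in[0,T]$ and every $M\in SO(3)$, $f(t_0+t,M\bar p)=f(t_0+t,\bar p)$ for almost every $\bar p\in\mathbb R^3$. (As $f(t)$ is an element of $L^1_2$, invariance is understood almost everywhere, for the datum as well.) 2. For every $t\in I$ the integrals $T^{\alpha\beta}(t)=\int_{\mathbb R^3}\frac{p^\alpha p^\beta f(t,\bar p)\,a^3(t)}{p^0}\,d\bar p$ converge absolutely, and the stress-energy tensor $T_{\alpha\beta}=g_{\alpha\lambda}g_{\beta\mu}T^{\lambda\mu}$, with $g=-dt^2+a^2(t)\,[(dx^1)^2+(dx^2)^2+(dx^3)^2]$, satisfies $$T_{11}=T_{22}=T_{33},\qquad T_{0i}=0,\qquad T_{ij}=0\ \ (i\ne j),\qquad i,j\in\{1,2,3\}.$$ 3. Consequently the Einstein equations $R_{\alpha\beta}-\frac12Rg_{\alpha\beta}+\Lambda g_{\alpha\beta}=8\pi T_{\alpha\beta}$ are compatible with the Robertson–Walker form of $g$: for every $\Lambda\in\mathbb R$, at every point whose time coordinate $t$ is in the interior of $I$ and such that $a$ is $C^2$ near $t$, all of them hold if and only if the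 $(0,0)$ and the $(1,1)$ equations hold. -/

import Mathlib

open MeasureTheory Set

noncomputable section

namespace RWBoltzmann

/-- Momentum space `ℝ³` with its Euclidean inner product and norm. -/
abbrev Mom : Type := EuclideanSpace ℝ (Fin 3)

/-! ### Function spaces -/

/-- The measure `√(1 + |p|²) dp` on `ℝ³`. -/
def weightedMeasure : Measure Mom :=
  (volume : Measure Mom).withDensity fun p => ENNReal.ofReal (√(1 + ‖p‖ ^ 2))

/-- The Banach space `L¹₂(ℝ³)` of (classes of) functions with `∫ √(1 + |p|²) |f(p)| dp < ∞`,
normed by that integral (see `L12.norm_def`). As the weight is at least `1`,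
it is a subspace of `L¹(ℝ³)`. -/
abbrev L12 : Type := Lp ℝ 1 weightedMeasure

theorem L12.norm_def (u : L12) : ‖u‖ = ∫ p : Mom, √(1 + ‖p‖ ^ 2) * |u p| := by
  have hm : Measurable fun p : Mom => ENNReal.ofReal (√(1 + ‖p‖ ^ 2)) := by fun_prop
  rw [L1.norm_eq_integral_norm]
  unfold weightedMeasure
  rw [integral_withDensity_eq_integral_toReal_smul hm (by simp)]
  refine integral_congr_ae (Filter.Eventually.of_forall fun p => ?_)
  simp [ENNReal.toReal_ofReal (Real.sqrt_nonneg _)]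

/-- The set `X_r` of almost everywhere non-negative elements of `L¹₂` of norm at most `r`. -/
def X (r : ℝ) : Set L12 :=
  {u | (∀ᵐ p : Mom, 0 ≤ u p) ∧ ‖u‖ ≤ r}

/-! ### Rotations -/

/-- A `3 × 3` matrix acting on momenta. -/
def act (M : Matrix (Fin 3) (Fin 3) ℝ) (p : Mom) : Mom := Matrix.toEuclideanLin M p

/-- `u` is invariant by `SO(3)`, as a function defined up to null sets. -/
def IsSO3Invariant (u : Mom → ℝ) : Prop :=
  ∀ M ∈ Matrix.specialOrthogonalGroup (Fin 3) ℝ, ∀ᵐ p : Mom, u (act M p) = u p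

/-! ### Collisions -/

/-- The energy `p⁰ = √(1 + a² |p|²)` of a particle of unit mass, for the expansion factor `a`. -/
def energy (a : ℝ) (p : Mom) : ℝ := √(1 + a ^ 2 * ‖p‖ ^ 2)

/-- The elementary energy `e = p⁰ + q⁰`. -/
def totalEnergy (a : ℝ) (p q : Mom) : ℝ := energy a p + energy a q

/-- The coefficient `b(p, q, ω)` of the momentum exchange along the unit vector `ω`: the solution of
the quadratic equation which expresses the conservation of energy
(see `energy_conservation`). Here `p / p⁰` and `q / q⁰` are the velocities. -/
def exchange (a : ℝ) (p q ω : Mom) : ℝ :=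
  2 * energy a p * energy a q * totalEnergy a p q
      * inner ℝ ω ((energy a q)⁻¹ • q - (energy a p)⁻¹ • p)
    / (totalEnergy a p q ^ 2 - a ^ 2 * inner ℝ ω (p + q) ^ 2)

/-- The momentum `p' = p + b(p, q, ω) ω`. -/
def postP (a : ℝ) (p q ω : Mom) : Mom := p + exchange a p q ω • ω

/-- The momentum `q' = q - b(p, q, ω) ω`. -/
def postQ (a : ℝ) (p q ω : Mom) : Mom := q - exchange a p q ω • ω

theorem energy_sq (a : ℝ) (p : Mom) : energy a p ^ 2 = 1 + a ^ 2 * ‖p‖ ^ 2 :=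
  Real.sq_sqrt (by positivity)

theorem energy_pos (a : ℝ) (p : Mom) : 0 < energy a p := Real.sqrt_pos.2 (by positivity)

theorem abs_mul_norm_lt_energy (a : ℝ) (p : Mom) : |a| * ‖p‖ < energy a p := by
  refine lt_of_pow_lt_pow_left₀ 2 (energy_pos a p).le ?_
  rw [energy_sq, mul_pow, sq_abs]
  linarith

theorem energy_le_add (a : ℝ) (p q : Mom) :
    energy a p ≤ |a| * ‖p + q‖ + energy a q := by
  have h1 : ‖p‖ ≤ ‖p + q‖ + ‖q‖ := by simpa using norm_sub_le (p + q) q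
  have h2 := abs_mul_norm_lt_energy a q
  have h3 := energy_sq a q
  have h4 : |a| ^ 2 = a ^ 2 := sq_abs a
  refine le_of_sq_le_sq ?_ (by have := energy_pos a q; positivity)
  rw [energy_sq]
  have h5 : ‖p‖ ^ 2 ≤ (‖p + q‖ + ‖q‖) ^ 2 := by gcongr
  have h6 : a ^ 2 * ‖p‖ ^ 2 ≤ a ^ 2 * (‖p + q‖ + ‖q‖) ^ 2 := by gcongr
  have h7 : |a| * ‖p + q‖ * (|a| * ‖q‖) ≤ |a| * ‖p + q‖ * energy a q := by gcongr
  rw [← h4] at h6 h3 ⊢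
  nlinarith

theorem abs_mul_norm_add_lt (a : ℝ) (p q : Mom) : |a| * ‖p + q‖ < totalEnergy a p q := by
  have h1 : |a| * ‖p + q‖ ≤ |a| * (‖p‖ + ‖q‖) := by gcongr; exact norm_add_le p q
  have h2 := abs_mul_norm_lt_energy a p
  have h3 := abs_mul_norm_lt_energy a q
  unfold totalEnergy
  linarith

/-- The denominator of `exchange` is positive. -/
theorem exchange_denom_pos (a : ℝ) (p q ω : Mom) (hω : ‖ω‖ = 1) :
    0 < totalEnergy a p q ^ 2 - a ^ 2 * inner ℝ ω (p + q) ^ 2 := by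
  have h1 : |inner ℝ ω (p + q)| ≤ ‖p + q‖ := by
    simpa [hω] using abs_real_inner_le_norm ω (p + q)
  have h2 : (|a| * |inner ℝ ω (p + q)|) ^ 2 < totalEnergy a p q ^ 2 := by
    refine pow_lt_pow_left₀ (lt_of_le_of_lt ?_ (abs_mul_norm_add_lt a p q)) (by positivity) two_ne_zero
    gcongr
  rw [mul_pow, sq_abs, sq_abs] at h2
  linarith

theorem energy_conservation (a : ℝ) (p q ω : Mom) (hω : ‖ω‖ = 1) :
    energy a (postP a p q ω) + energy a (postQ a p q ω) = energy a p + energy a q := by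
  have hP := energy_pos a p
  have hQ := energy_pos a q
  have hD := exchange_denom_pos a p q ω hω
  have hlt := abs_mul_norm_add_lt a p q
  have hsum : postP a p q ω + postQ a p q ω = p + q := by simp only [postP, postQ]; abel
  have hle1 := energy_le_add a (postP a p q ω) (postQ a p q ω)
  have hle2 := energy_le_add a (postQ a p q ω) (postP a p q ω)
  rw [add_comm (postQ a p q ω), hsum] at hle2
  rw [hsum] at hle1
  have hp' := energy_pos a (postP a p q ω)
  have hq' := energy_pos a (postQ a p q ω)
  have sp' := energy_sq a (postP a p q ω)
  have sq' := energy_sq a (postQ a p q ω)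
  have hb : exchange a p q ω * (totalEnergy a p q ^ 2 - a ^ 2 * inner ℝ ω (p + q) ^ 2)
      = 2 * totalEnergy a p q
        * (energy a p * inner ℝ ω q - energy a q * inner ℝ ω p) := by
    unfold exchange
    rw [div_mul_cancel₀ _ hD.ne', inner_sub_right, inner_smul_right, inner_smul_right]
    field_simp
  have n1 : ‖postP a p q ω‖ ^ 2
      = ‖p‖ ^ 2 + 2 * exchange a p q ω * inner ℝ ω p + exchange a p q ω ^ 2 := by
    rw [postP, norm_add_sq_real, norm_smul, hω, inner_smul_right, real_inner_comm, mul_one,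
      Real.norm_eq_abs, sq_abs]
    ring
  have n2 : ‖postQ a p q ω‖ ^ 2
      = ‖q‖ ^ 2 - 2 * exchange a p q ω * inner ℝ ω q + exchange a p q ω ^ 2 := by
    rw [postQ, norm_sub_sq_real, norm_smul, hω, inner_smul_right, real_inner_comm, mul_one,
      Real.norm_eq_abs, sq_abs]
    ring
  have eP := energy_sq a p
  have eQ := energy_sq a q
  rw [n1] at sp'
  rw [n2] at sq'
  rw [inner_add_right] at hb
  have he : totalEnergy a p q = energy a p + energy a q := rfl
  rw [he] at hb hlt
  generalize exchange a p q ω = b at *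
  generalize energy a (postP a p q ω) = P' at *
  generalize energy a (postQ a p q ω) = Q' at *
  generalize energy a p = P at *
  generalize energy a q = Q at *
  generalize (inner ℝ ω p : ℝ) = x at *
  generalize (inner ℝ ω q : ℝ) = y at *
  have hE : 0 < P + Q := by positivity
  set c := a ^ 2 * b * (x + y) / (P + Q) with hc
  have hc' : c * (P + Q) = a ^ 2 * b * (x + y) := by rw [hc]; field_simp
  have k1 : P' ^ 2 = (P + c) ^ 2 := by
    have : (P + Q) ^ 2 * (P' ^ 2 - (P + c) ^ 2) = 0 := by
      linear_combination (P + Q) ^ 2 * sp' - (P + Q) ^ 2 * eP - 2 * P * (P + Q) * hc'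
        - (c * (P + Q) + a ^ 2 * b * (x + y)) * hc' + a ^ 2 * b * hb
    have h := (mul_eq_zero.1 this).resolve_left (by positivity)
    linarith
  have k2 : Q' ^ 2 = (Q - c) ^ 2 := by
    have : (P + Q) ^ 2 * (Q' ^ 2 - (Q - c) ^ 2) = 0 := by
      linear_combination (P + Q) ^ 2 * sq' - (P + Q) ^ 2 * eQ + 2 * Q * (P + Q) * hc'
        - (c * (P + Q) + a ^ 2 * b * (x + y)) * hc' + a ^ 2 * b * hb
    have h := (mul_eq_zero.1 this).resolve_left (by positivity)
    linarith
  rcases sq_eq_sq_iff_eq_or_eq_neg.1 k1 with h1 | h1 <;>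
    rcases sq_eq_sq_iff_eq_or_eq_neg.1 k2 with h2 | h2 <;> linarith

/-- Hypotheses on a collision kernel `A(a, p, q, p', q')`, with constants `C₁` and `γ`:
non-negativity and boundedness, the two symmetries, Lipschitz continuity in the expansion factor,
and, as the only regularity in the momenta, measurability. -/
structure IsCollisionKernel (A : ℝ → Mom → Mom → Mom → Mom → ℝ) (C₁ γ : ℝ) : Prop where
  measurable : ∀ a, 0 < a →
    Measurable fun x : Mom × Mom × Mom × Mom => A a x.1 x.2.1 x.2.2.1 x.2.2.2
  nonneg : ∀ a, 0 < a → ∀ p q p' q', 0 ≤ A a p q p' q'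
  le_bound : ∀ a, 0 < a → ∀ p q p' q', A a p q p' q' ≤ C₁
  symm_swap : ∀ a, 0 < a → ∀ p q p' q', A a p q p' q' = A a q p q' p'
  symm_reverse : ∀ a, 0 < a → ∀ p q p' q', A a p q p' q' = A a p' q' p q
  lipschitz : ∀ a₁ a₂, 0 < a₁ → 0 < a₂ → ∀ p q p' q',
    |A a₁ p q p' q' - A a₂ p q p' q'| ≤ γ * |a₁ - a₂|

/-- The unit sphere `S²`. -/
abbrev S2 : Type := Metric.sphere (0 : Mom) 1

/-- The area measure `dω` of the unit sphere. -/
def sphereMeasure : Measure S2 := (volume : Measure Mom).toSphere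

/-- The gain term `Q⁺(u, v)`. -/
def gain (A : ℝ → Mom → Mom → Mom → Mom → ℝ) (a : ℝ) (u v : Mom → ℝ) (p : Mom) : ℝ :=
  ∫ q : Mom, a ^ 3 / energy a q * ∫ ω : S2,
    u (postP a p q ω) * v (postQ a p q ω) * A a p q (postP a p q ω) (postQ a p q ω) ∂sphereMeasure

/-- The loss term `Q⁻(u, v)`. -/
def loss (A : ℝ → Mom → Mom → Mom → Mom → ℝ) (a : ℝ) (u v : Mom → ℝ) (p : Mom) : ℝ :=
  ∫ q : Mom, a ^ 3 / energy a q * ∫ ω : S2,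
    u p * v q * A a p q (postP a p q ω) (postQ a p q ω) ∂sphereMeasure

/-- The collision operator `Q = Q⁺ - Q⁻`. -/
def collision (A : ℝ → Mom → Mom → Mom → Mom → ℝ) (a : ℝ) (u v : Mom → ℝ) (p : Mom) : ℝ :=
  gain A a u v p - loss A a u v p

/-- `f ∈ C([t₀, t₀ + T]; X_r)` solves the Boltzmann equation with initial datum `f₀` in integral
form, `f(t₀ + t) = f₀ + ∫_{t₀}^{t₀ + t} (1 / p⁰) Q(f, f)(s) ds` for `0 ≤ t ≤ T`. The integral is
that of the `L¹₂`-valued function `G : s ↦ (1 / p⁰) Q(f(s), f(s))`; note that `p⁰` depends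
on `s` through `a(s)`. -/
structure IsBoltzmannSolution (A : ℝ → Mom → Mom → Mom → Mom → ℝ) (a : ℝ → ℝ) (t₀ T r : ℝ)
    (f₀ : L12) (f : ℝ → L12) : Prop where
  continuousOn : ContinuousOn f (Icc t₀ (t₀ + T))
  mem_X : ∀ s ∈ Icc t₀ (t₀ + T), f s ∈ X r
  integral_eq : ∃ G : ℝ → L12,
    (∀ s ∈ Icc t₀ (t₀ + T), ∀ᵐ p : Mom,
      G s p = 1 / energy (a s) p * collision A (a s) (f s) (f s) p) ∧
    IntervalIntegrable G volume t₀ (t₀ + T) ∧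
    ∀ t ∈ Icc 0 T, f (t₀ + t) = f₀ + ∫ s in t₀..(t₀ + t), G s

/-! ### The stress-energy tensor -/

/-- The 4-momentum `(p⁰, p¹, p², p³)` on the mass shell. -/
def fourMomentum (a : ℝ) (p : Mom) : Fin 4 → ℝ := ![energy a p, p 0, p 1, p 2]

/-- The matrix of the metric `-dt² + a² (dx₁² + dx₂² + dx₃²)`. -/
def rwMetric (a : ℝ) : Matrix (Fin 4) (Fin 4) ℝ :=
  Matrix.diagonal ![-1, a ^ 2, a ^ 2, a ^ 2]

/-- The integrand `p^α p^β u(p) |g|^{1/2} / p⁰` of `T^{αβ}`, where `|g|^{1/2} = a³`. -/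
def stressIntegrand (a : ℝ) (u : Mom → ℝ) (α β : Fin 4) (p : Mom) : ℝ :=
  fourMomentum a p α * fourMomentum a p β * u p * a ^ 3 / energy a p

/-- The contravariant components `T^{αβ}`. -/
def stressUp (a : ℝ) (u : Mom → ℝ) (α β : Fin 4) : ℝ := ∫ p : Mom, stressIntegrand a u α β p

/-- The covariant components `T_{αβ} = g_{αλ} g_{βμ} T^{λμ}`. -/
def stress (a : ℝ) (u : Mom → ℝ) (α β : Fin 4) : ℝ :=
  ∑ l : Fin 4, ∑ m : Fin 4, rwMetric a α l * rwMetric a β m * stressUp a u l m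

/-! ### Curvature and the Einstein equations -/

/-- The partial derivative `∂_μ F` of a function on `ℝ⁴`. -/
def partialD (μ : Fin 4) (F : (Fin 4 → ℝ) → ℝ) (x : Fin 4 → ℝ) : ℝ :=
  deriv (fun s => F (Function.update x μ s)) (x μ)

/-- The Christoffel symbols `Γ^l_{αβ}` of a metric `g` on `ℝ⁴`. -/
def christoffel (g : (Fin 4 → ℝ) → Matrix (Fin 4) (Fin 4) ℝ) (l α β : Fin 4)
    (x : Fin 4 → ℝ) : ℝ :=
  1 / 2 * ∑ m : Fin 4, (g x)⁻¹ l m *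
    (partialD α (fun y => g y m β) x + partialD β (fun y => g y α m) x
      - partialD m (fun y => g y α β) x)

/-- The curvature `R^l_{m, αβ} = ∂_α Γ^l_{mβ} - ∂_β Γ^l_{mα} + Γ^l_{nα} Γ^n_{mβ}
- Γ^l_{nβ} Γ^n_{mα}`. -/
def riemann (g : (Fin 4 → ℝ) → Matrix (Fin 4) (Fin 4) ℝ) (l m α β : Fin 4)
    (x : Fin 4 → ℝ) : ℝ :=
  partialD α (christoffel g l m β) x - partialD β (christoffel g l m α) x
    + ∑ n : Fin 4, (christoffel g l n α x * christoffel g n m β x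
      - christoffel g l n β x * christoffel g n m α x)

/-- The Ricci tensor `R_{αβ} = R^l_{α, lβ}`. -/
def ricci (g : (Fin 4 → ℝ) → Matrix (Fin 4) (Fin 4) ℝ) (α β : Fin 4) (x : Fin 4 → ℝ) : ℝ :=
  ∑ l : Fin 4, riemann g l α l β x

/-- The scalar curvature `R = g^{αβ} R_{αβ}`. -/
def scalarCurvature (g : (Fin 4 → ℝ) → Matrix (Fin 4) (Fin 4) ℝ) (x : Fin 4 → ℝ) : ℝ :=
  ∑ α : Fin 4, ∑ β : Fin 4, (g x)⁻¹ α β * ricci g α β x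

/-- The `(α, β)` component of the Einstein equations `R_{αβ} - (1/2) R g_{αβ} + Λ g_{αβ} = 8 π T_{αβ}`
at the point `x`, for the Robertson-Walker metric with expansion factor `a` and the
stress-energy tensor generated by `f`. -/
def EinsteinEq (Λ : ℝ) (a : ℝ → ℝ) (f : ℝ → L12) (x : Fin 4 → ℝ) (α β : Fin 4) : Prop :=
  ricci (fun y => rwMetric (a (y 0))) α β x
      - 1 / 2 * scalarCurvature (fun y => rwMetric (a (y 0))) x * rwMetric (a (x 0)) α β
      + Λ * rwMetric (a (x 0)) α β
    = 8 * Real.pi * stress (a (x 0)) (f (x 0)) α β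

end RWBoltzmann

end

open RWBoltzmann

noncomputable section

namespace RWBoltzmann

/-! ### Rotations -/

/-! The solution is invariant because the equation determines it. If `R` is a rotation, then `f ∘ R`
satisfies the same integral equation with the same datum. Indeed, energies, `exchange` and the
measures `dq` and `dω` are rotation invariant and the kernel is assumed to be, so the collision
operator commutes with `R` (`collision_isometry`). The difference `f - f ∘ R` is thus the time
integral of a difference of collision terms. If the collision operator is Lipschitz on bounded sets
of `L12`, Grönwall's lemma makes it vanish (`eq_zero_of_integral_eq_of_norm_le`).

The Lipschitz bound (`lintegral_collision_sub_le`) is the analytic core. By bilinearity it reduces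
to bounding the gain and loss terms by products of `L¹` norms. For the gain term this needs the fact
that, for fixed `ω`, the map `(p, q) ↦ (p', q')` preserves `dp dq / (p⁰ q⁰)`
(`lintegral_collision`). That map fixes `p + q` and moves `p` along `ω`, so it acts on lines. On
each line it is a differentiable involution of `ℝ` (`lineMap_lineMap`) with at most one fixed point
(`subsingleton_exchange_eq_zero`). Differentiating the conservation of energy along the line gives
its derivative, `-(p'⁰ q'⁰) / (p⁰ q⁰)`, off the fixed point (`deriv_lineMap`). Since the total
energy is conserved and dominates the weight of `L12`, the weight costs nothing
(`IsTransition.lintegral_transitionBound_le`).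

Given invariance, half-turns kill the off-diagonal stress components and a cyclic rotation
identifies the spatial diagonal ones. The Einstein tensor of the metric has the same shape, by the
index pattern of the Christoffel symbols (`ricci_rwMetric`), so only the `(0,0)` and `(1,1)`
equations carry information. -/

theorem exists_isometry_eq_act {M : Matrix (Fin 3) (Fin 3) ℝ}
    (hM : M ∈ Matrix.specialOrthogonalGroup (Fin 3) ℝ) :
    ∃ R : Mom ≃ₗᵢ[ℝ] Mom, ∀ p, R p = act M p := by
  have hMM : star M * M = 1 :=
    (Matrix.mem_orthogonalGroup_iff' (Fin 3) ℝ).1 (Matrix.mem_specialOrthogonalGroup_iff.1 hM).1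
  have hinner : ∀ x y : Mom, inner ℝ (act M x) (act M y) = inner ℝ x y := by
    intro x y
    have h : Matrix.toEuclideanLin (star M) (Matrix.toEuclideanLin M y) = y := by
      simp only [Matrix.toLpLin_apply, Matrix.mulVec_mulVec, hMM, Matrix.one_mulVec]
    rw [Matrix.star_eq_conjTranspose, Matrix.toEuclideanLin_conjTranspose_eq_adjoint] at h
    unfold act
    rw [← LinearMap.adjoint_inner_right, h]
  let R : Mom →ₗᵢ[ℝ] Mom := (Matrix.toEuclideanLin M).isometryOfInner hinner
  exact ⟨R.toLinearIsometryEquiv rfl, fun p => rfl⟩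

theorem lintegral_comp_isometry (R : Mom ≃ₗᵢ[ℝ] Mom) (F : Mom → ENNReal) :
    ∫⁻ p, F (R p) = ∫⁻ p, F p :=
  R.measurePreserving.lintegral_comp_emb R.toHomeomorph.measurableEmbedding F

theorem integral_comp_isometry (R : Mom ≃ₗᵢ[ℝ] Mom) (F : Mom → ℝ) :
    ∫ p, F (R p) = ∫ p, F p :=
  R.measurePreserving.integral_comp R.toHomeomorph.measurableEmbedding F

/-- A linear isometry acting on the unit sphere. -/
def sphereMap (R : Mom ≃ₗᵢ[ℝ] Mom) : S2 ≃ₜ S2 :=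
  R.toHomeomorph.subtype fun p => by simp

@[simp]
theorem coe_sphereMap (R : Mom ≃ₗᵢ[ℝ] Mom) (ω : S2) : (sphereMap R ω : Mom) = R ω := rfl

instance : IsFiniteMeasure sphereMeasure := by unfold sphereMeasure; infer_instance

/-- Spherical area is a multiple of the volume of the cone over a set, and a linear isometry pulls
the cone over `s` back to the cone over the preimage of `s`. -/
theorem measurePreserving_sphereMap (R : Mom ≃ₗᵢ[ℝ] Mom) :
    MeasurePreserving (sphereMap R) sphereMeasure sphereMeasure := by
  refine ⟨(sphereMap R).continuous.measurable, Measure.ext fun s hs => ?_⟩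
  have hs' := (sphereMap R).continuous.measurable hs
  rw [Measure.map_apply (sphereMap R).continuous.measurable hs, sphereMeasure,
    Measure.toSphere_apply' _ hs', Measure.toSphere_apply' _ hs]
  congr 1
  conv_rhs => rw [← R.measurePreserving.measure_preimage_equiv (f := R.toHomeomorph.toMeasurableEquiv)]
  congr 1
  ext p
  simp only [mem_smul, mem_image, mem_preimage]
  constructor
  · rintro ⟨c, hc, _, ⟨ω, hω, rfl⟩, rfl⟩
    exact ⟨c, hc, R ω, ⟨sphereMap R ω, hω, rfl⟩, (map_smul R c (ω : Mom)).symm⟩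
  · rintro ⟨c, hc, _, ⟨ω, hω, rfl⟩, h⟩
    refine ⟨c, hc, R.symm ω, ⟨(sphereMap R).symm ω, by simpa using hω, rfl⟩, ?_⟩
    rw [← map_smul, h]
    exact R.symm_apply_apply p

theorem integral_sphere_comp_isometry (R : Mom ≃ₗᵢ[ℝ] Mom) (F : S2 → ℝ) :
    ∫ ω, F (sphereMap R ω) ∂sphereMeasure = ∫ ω, F ω ∂sphereMeasure :=
  (measurePreserving_sphereMap R).integral_comp (sphereMap R).measurableEmbedding F

/-! ### Rotations and the collision operator -/

theorem energy_isometry (a : ℝ) (R : Mom ≃ₗᵢ[ℝ] Mom) (p : Mom) :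
    energy a (R p) = energy a p := by
  simp [energy]

theorem exchange_isometry (a : ℝ) (R : Mom ≃ₗᵢ[ℝ] Mom) (p q ω : Mom) :
    exchange a (R p) (R q) (R ω) = exchange a p q ω := by
  simp only [exchange, totalEnergy, energy_isometry, ← map_smul, ← map_sub, ← map_add,
    R.inner_map_map]

theorem postP_isometry (a : ℝ) (R : Mom ≃ₗᵢ[ℝ] Mom) (p q ω : Mom) :
    postP a (R p) (R q) (R ω) = R (postP a p q ω) := by
  simp [postP, exchange_isometry]

theorem postQ_isometry (a : ℝ) (R : Mom ≃ₗᵢ[ℝ] Mom) (p q ω : Mom) :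
    postQ a (R p) (R q) (R ω) = R (postQ a p q ω) := by
  simp [postQ, exchange_isometry]

/-- Substitute `q ↦ R q` and `ω ↦ R ω` in both integrals; every other ingredient is equivariant. No
integrability is needed, since the substitutions hold for arbitrary integrands. -/
theorem collision_isometry {A : ℝ → Mom → Mom → Mom → Mom → ℝ} {a : ℝ} (R : Mom ≃ₗᵢ[ℝ] Mom)
    (hA : ∀ p q p' q', A a (R p) (R q) (R p') (R q') = A a p q p' q') (u v : Mom → ℝ) (p : Mom) :
    collision A a u v (R p) = collision A a (u ∘ R) (v ∘ R) p := by
  unfold collision gain loss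
  congr 1
  all_goals
    rw [← integral_comp_isometry R]
    refine integral_congr_ae (Filter.Eventually.of_forall fun q => ?_)
    simp only [energy_isometry]
    congr 1
    rw [← integral_sphere_comp_isometry R]
    simp only [coe_sphereMap, postP_isometry, postQ_isometry, hA, Function.comp_apply]

/-! ### The stress-energy tensor of a rotation invariant density -/

theorem abs_fourMomentum_le {a : ℝ} (ha : 1 ≤ a) (α : Fin 4) (p : Mom) :
    |fourMomentum a p α| ≤ energy a p := by
  have key : ∀ i : Fin 3, |p i| ≤ energy a p := fun i => by
    have h1 : |p i| ≤ ‖p‖ := by simpa using PiLp.norm_apply_le p i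
    have h2 := abs_mul_norm_lt_energy a p
    rw [abs_of_pos (by linarith)] at h2
    nlinarith [norm_nonneg p]
  fin_cases α
  · simp [fourMomentum, abs_of_pos (energy_pos a p)]
  · exact key 0
  · exact key 1
  · exact key 2

theorem energy_le_mul_weight {a : ℝ} (ha : 1 ≤ a) (p : Mom) :
    energy a p ≤ a * √(1 + ‖p‖ ^ 2) := by
  rw [energy, show a * √(1 + ‖p‖ ^ 2) = √(a ^ 2 * (1 + ‖p‖ ^ 2)) by
    rw [Real.sqrt_mul (by positivity), Real.sqrt_sq (by linarith)]]
  gcongr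
  nlinarith

theorem continuous_energy (a : ℝ) : Continuous (energy a) := by
  unfold energy; fun_prop

theorem continuous_fourMomentum (a : ℝ) (α : Fin 4) : Continuous fun p => fourMomentum a p α := by
  fin_cases α
  · exact continuous_energy a
  · exact (by fun_prop : Continuous fun p : Mom => p 0)
  · exact (by fun_prop : Continuous fun p : Mom => p 1)
  · exact (by fun_prop : Continuous fun p : Mom => p 2)

theorem measurable_weight : Measurable fun p : Mom => ENNReal.ofReal (√(1 + ‖p‖ ^ 2)) := by
  fun_prop

theorem one_le_weight (p : Mom) : 1 ≤ √(1 + ‖p‖ ^ 2) := by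
  rw [Real.one_le_sqrt]; nlinarith [norm_nonneg p]

/-- The weight never vanishes, so the weighted measure and Lebesgue measure have the same null sets.
-/
theorem ae_weightedMeasure_iff {P : Mom → Prop} :
    (∀ᵐ p ∂weightedMeasure, P p) ↔ ∀ᵐ p : Mom, P p := by
  unfold weightedMeasure
  rw [ae_withDensity_iff measurable_weight]
  simp [fun p : Mom => zero_lt_one.trans_le (one_le_weight p)]

theorem integrable_weight_mul (u : L12) : Integrable fun p : Mom => √(1 + ‖p‖ ^ 2) * u p := by
  have h := (memLp_one_iff_integrable.1 (Lp.memLp u))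
  unfold weightedMeasure at h
  rw [integrable_withDensity_iff_integrable_smul' measurable_weight (by simp)] at h
  simp only [ENNReal.toReal_ofReal (Real.sqrt_nonneg _), smul_eq_mul] at h
  exact h

/-- Each momentum component is at most `p⁰`: one factor cancels the denominator, and the other is at
most `a` times the weight. Together with `a ^ 3` this gives the constant `a ^ 4`. -/
theorem integrable_stressIntegrand {a : ℝ} (ha : 1 ≤ a) (u : L12) (α β : Fin 4) :
    Integrable (stressIntegrand a u α β) := by
  have hu : AEStronglyMeasurable u (volume : Measure Mom) :=
    (Lp.stronglyMeasurable u).aestronglyMeasurable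
  refine ((integrable_weight_mul u).norm.const_mul (a ^ 4)).mono' ?_ ?_
  · unfold stressIntegrand
    have h1 := (continuous_fourMomentum a α).aestronglyMeasurable (μ := (volume : Measure Mom))
    have h2 := (continuous_fourMomentum a β).aestronglyMeasurable (μ := (volume : Measure Mom))
    have h3 := ((continuous_energy a).inv₀ fun p => (energy_pos a p).ne').aestronglyMeasurable
      (μ := (volume : Measure Mom))
    simp only [div_eq_mul_inv]
    exact (((h1.mul h2).mul hu).mul_const _).mul h3
  · refine Filter.Eventually.of_forall fun p => ?_
    have hE := energy_pos a p
    have h1 := abs_fourMomentum_le ha α p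
    have h2 := abs_fourMomentum_le ha β p
    have h3 := energy_le_mul_weight ha p
    have ha3 : 0 ≤ a ^ 3 := by positivity
    have hw := Real.sqrt_nonneg (1 + ‖p‖ ^ 2)
    simp only [stressIntegrand, norm_div, norm_mul, Real.norm_eq_abs, abs_of_pos hE,
      abs_of_nonneg ha3, abs_of_nonneg hw]
    rw [div_le_iff₀ hE]
    calc |fourMomentum a p α| * |fourMomentum a p β| * |u p| * a ^ 3
        ≤ energy a p * energy a p * |u p| * a ^ 3 := by gcongr
      _ ≤ a * √(1 + ‖p‖ ^ 2) * energy a p * |u p| * a ^ 3 := by gcongr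
      _ = _ := by ring

theorem stress_eq (a : ℝ) (u : Mom → ℝ) (α β : Fin 4) :
    stress a u α β = rwMetric a α α * rwMetric a β β * stressUp a u α β := by
  unfold stress
  rw [Finset.sum_eq_single α, Finset.sum_eq_single β]
  · intro m _ hm
    simp [rwMetric, Matrix.diagonal_apply_ne _ hm.symm]
  · simp
  · intro l _ hl
    simp [rwMetric, Matrix.diagonal_apply_ne _ hl.symm]
  · simp

/-- If a rotation carries `p^α p^β` to `c p^γ p^δ`, the corresponding components are proportional. -/
theorem stressUp_eq_of_rotation {a : ℝ} {u : Mom → ℝ} (hu : IsSO3Invariant u)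
    {M : Matrix (Fin 3) (Fin 3) ℝ} (hM : M ∈ Matrix.specialOrthogonalGroup (Fin 3) ℝ)
    {α β γ δ : Fin 4} {c : ℝ}
    (h : ∀ p, fourMomentum a (act M p) α * fourMomentum a (act M p) β
      = c * (fourMomentum a p γ * fourMomentum a p δ)) :
    stressUp a u α β = c * stressUp a u γ δ := by
  obtain ⟨R, hR⟩ := exists_isometry_eq_act hM
  unfold stressUp
  rw [← integral_comp_isometry R, ← integral_const_mul]
  refine integral_congr_ae ?_
  filter_upwards [hu M hM] with p hp
  simp only [stressIntegrand, energy_isometry]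
  rw [hR, h, hp]
  ring

theorem act_apply (M : Matrix (Fin 3) (Fin 3) ℝ) (p : Mom) (i : Fin 3) :
    act M p i = ∑ j, M i j * p j := rfl

theorem diagonal_mem_SO3 (x y z : ℝ) (hx : x * x = 1) (hy : y * y = 1) (hz : z * z = 1)
    (h : x * y * z = 1) :
    Matrix.diagonal ![x, y, z] ∈ Matrix.specialOrthogonalGroup (Fin 3) ℝ := by
  rw [Matrix.mem_specialOrthogonalGroup_iff, Matrix.mem_orthogonalGroup_iff]
  constructor
  · ext i j
    fin_cases i <;> fin_cases j <;> simp [*]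
  · simp [Matrix.det_diagonal, Fin.prod_univ_three, h]

/-- The rotation `p ↦ (p 1, p 2, p 0)`. -/
def cyclicRotation : Matrix (Fin 3) (Fin 3) ℝ := !![0, 1, 0; 0, 0, 1; 1, 0, 0]

theorem cyclicRotation_mem_SO3 :
    cyclicRotation ∈ Matrix.specialOrthogonalGroup (Fin 3) ℝ := by
  rw [Matrix.mem_specialOrthogonalGroup_iff, Matrix.mem_orthogonalGroup_iff]
  constructor
  · ext i j
    fin_cases i <;> fin_cases j <;>
      simp [cyclicRotation, Matrix.mul_apply, Fin.sum_univ_three]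
  · simp [cyclicRotation, Matrix.det_fin_three]

theorem stressUp_diag {a : ℝ} {u : Mom → ℝ} (hu : IsSO3Invariant u) :
    stressUp a u 1 1 = stressUp a u 2 2 ∧ stressUp a u 2 2 = stressUp a u 3 3 := by
  constructor
  all_goals
    rw [stressUp_eq_of_rotation (c := 1) hu cyclicRotation_mem_SO3, one_mul]
    intro p
    simp [fourMomentum, act_apply, cyclicRotation, Fin.sum_univ_three]

/-- Half-turns about the first two axes suffice: for any two distinct indices, at least one of them
reverses the sign of `p^α p^β`, so the component equals its own negative. -/
theorem stressUp_offDiag {a : ℝ} {u : Mom → ℝ} (hu : IsSO3Invariant u) {α β : Fin 4}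
    (h : α ≠ β) : stressUp a u α β = 0 := by
  have h1 := diagonal_mem_SO3 1 (-1) (-1) (by simp) (by simp) (by simp) (by simp)
  have h2 := diagonal_mem_SO3 (-1) 1 (-1) (by simp) (by simp) (by simp) (by simp)
  have key : stressUp a u α β = -1 * stressUp a u α β := by
    -- The split selects a half-turn uniformly in the indices: when the first fails to reverse the
    -- sign, the second must succeed.
    by_cases hc : ∀ p, fourMomentum a (act (Matrix.diagonal ![1, -1, -1]) p) α
        * fourMomentum a (act (Matrix.diagonal ![1, -1, -1]) p) β
        = -1 * (fourMomentum a p α * fourMomentum a p β)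
    · exact stressUp_eq_of_rotation hu h1 hc
    · refine stressUp_eq_of_rotation hu h2 fun p => ?_
      obtain ⟨R, hR⟩ := exists_isometry_eq_act h2
      obtain ⟨S, hS⟩ := exists_isometry_eq_act h1
      have e : energy a (act (Matrix.diagonal ![-1, 1, -1]) p) = energy a p := by
        rw [← hR, energy_isometry]
      have e' : ∀ p, energy a (act (Matrix.diagonal ![1, -1, -1]) p) = energy a p := fun p => by
        rw [← hS, energy_isometry]
      fin_cases α <;> fin_cases β <;>
        simp_all [fourMomentum, act_apply, Matrix.diagonal_apply]
  linarith

/-! ### The Einstein tensor of the Robertson-Walker metric -/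

/-- Only the isotropic diagonal shape of the inverse matters later. It persists at `a = 0`, where
the matrix inverse takes its default value `0`, so no case distinction is passed on. -/
theorem exists_inv_rwMetric : ∃ d₀ d₁ : ℝ → ℝ, ∀ a,
    (rwMetric a)⁻¹ = Matrix.diagonal ![d₀ a, d₁ a, d₁ a, d₁ a] := by
  have h : ∀ a, ∃ x y : ℝ, (rwMetric a)⁻¹ = Matrix.diagonal ![x, y, y, y] := by
    intro a
    unfold rwMetric
    rw [Matrix.inv_diagonal]
    by_cases hv : IsUnit (![-1, a ^ 2, a ^ 2, a ^ 2] : Fin 4 → ℝ)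
    · refine ⟨-1, (a ^ 2)⁻¹, congrArg _ ?_⟩
      have ha : a ^ 2 ≠ 0 := (Pi.isUnit_iff.1 hv 1).ne_zero
      rw [Ring.inverse_of_isUnit hv, Units.inv_eq_of_mul_eq_one_right]
      ext i
      fin_cases i <;> simp [ha]
    · refine ⟨0, 0, congrArg _ ?_⟩
      rw [Ring.inverse_non_unit _ hv]
      ext i
      fin_cases i <;> rfl
  choose d₀ d₁ hd using h
  exact ⟨d₀, d₁, hd⟩

theorem partialD_comp_time (μ : Fin 4) (F : ℝ → ℝ) (x : Fin 4 → ℝ) :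
    partialD μ (fun y => F (y 0)) x = if μ = 0 then deriv F (x 0) else 0 := by
  unfold partialD
  split_ifs with h
  · subst h; simp
  · simp [Function.update_of_ne (Ne.symm h)]

/-- The nonzero symbols are `Γ⁰_{ii}` and `Γⁱ_{0i} = Γⁱ_{i0}`, independent of `i`. They are given as
functions of time, not just pointwise values, because the curvature differentiates them again. -/
theorem exists_christoffel_rwMetric (a : ℝ → ℝ) : ∃ Γ₀ Γ₁ : ℝ → ℝ, ∀ l α β : Fin 4,
    christoffel (fun y => rwMetric (a (y 0))) l α β = fun y =>
      (if l = 0 then if α = β ∧ α ≠ 0 then Γ₀ else 0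
        else if (α = 0 ∧ β = l) ∨ (β = 0 ∧ α = l) then Γ₁ else 0) (y 0) := by
  obtain ⟨d₀, d₁, hd⟩ := exists_inv_rwMetric
  refine ⟨fun t => -(1 / 2 * d₀ (a t) * deriv (fun s => a s ^ 2) t),
    fun t => 1 / 2 * d₁ (a t) * deriv (fun s => a s ^ 2) t, fun l α β => funext fun x => ?_⟩
  have hp : ∀ μ m n : Fin 4, partialD μ (fun y => rwMetric (a (y 0)) m n) x
      = if μ = 0 then (if m = n ∧ m ≠ 0 then deriv (fun s => a s ^ 2) (x 0) else 0) else 0 := by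
    intro μ m n
    rw [partialD_comp_time μ (fun s => rwMetric (a s) m n) x]
    congr 1
    fin_cases m <;> fin_cases n <;> simp [rwMetric]
  unfold christoffel
  simp only [hd, hp, Matrix.diagonal_apply, Fin.sum_univ_four]
  fin_cases l <;> fin_cases α <;> fin_cases β <;> simp <;> ring

/-- Follows from the index pattern alone, whatever `Γ₀`, `Γ₁` and their derivatives are; the
components are never evaluated in terms of `a`. -/
theorem ricci_rwMetric (a : ℝ → ℝ) (x : Fin 4 → ℝ) :
    (∀ α β : Fin 4, α ≠ β → ricci (fun y => rwMetric (a (y 0))) α β x = 0) ∧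
    ∀ α : Fin 4, α ≠ 0 → ricci (fun y => rwMetric (a (y 0))) α α x
      = ricci (fun y => rwMetric (a (y 0))) 1 1 x := by
  obtain ⟨Γ₀, Γ₁, hΓ⟩ := exists_christoffel_rwMetric a
  have h0 : deriv (0 : ℝ → ℝ) = 0 := by ext; simp
  unfold ricci riemann
  simp only [hΓ, partialD_comp_time, Fin.sum_univ_four]
  constructor
  · intro α β h
    fin_cases α <;> fin_cases β <;> simp [h0] at h ⊢
  · intro α h
    fin_cases α <;> simp at h ⊢

/-- Off the diagonal both sides vanish; the three spatial diagonal equations are literally the same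
equation. -/
theorem einsteinEq_iff (Λ : ℝ) (a : ℝ → ℝ) (f : ℝ → L12) (x : Fin 4 → ℝ)
    (h12 : stress (a (x 0)) (f (x 0)) 1 1 = stress (a (x 0)) (f (x 0)) 2 2)
    (h23 : stress (a (x 0)) (f (x 0)) 2 2 = stress (a (x 0)) (f (x 0)) 3 3)
    (hoff : ∀ α β : Fin 4, α ≠ β → stress (a (x 0)) (f (x 0)) α β = 0) :
    (∀ α β : Fin 4, EinsteinEq Λ a f x α β) ↔
      EinsteinEq Λ a f x 0 0 ∧ EinsteinEq Λ a f x 1 1 := by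
  obtain ⟨r1, r2⟩ := ricci_rwMetric a x
  refine ⟨fun h => ⟨h 0 0, h 1 1⟩, fun ⟨h0, h1⟩ α β => ?_⟩
  by_cases h : α = β
  · subst h
    by_cases hα : α = 0
    · subst hα; exact h0
    · unfold EinsteinEq at h1 ⊢
      have hg : rwMetric (a (x 0)) α α = rwMetric (a (x 0)) 1 1 := by
        fin_cases α <;> simp [rwMetric] at hα ⊢
      have hs : stress (a (x 0)) (f (x 0)) α α = stress (a (x 0)) (f (x 0)) 1 1 := by
        fin_cases α <;> simp_all
      rw [r2 α hα, hg, hs]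
      exact h1
  · unfold EinsteinEq
    rw [r1 α β h, hoff α β h, rwMetric, Matrix.diagonal_apply_ne _ h]
    simp

/-! ### The collision map is an involution which preserves `dp dq / (p⁰ q⁰)` -/

theorem exchange_mul_denom (a : ℝ) (p q ω : Mom) (hω : ‖ω‖ = 1) :
    exchange a p q ω * (totalEnergy a p q ^ 2 - a ^ 2 * inner ℝ ω (p + q) ^ 2)
      = 2 * totalEnergy a p q
        * (energy a p * inner ℝ ω q - energy a q * inner ℝ ω p) := by
  have hP := energy_pos a p
  have hQ := energy_pos a q
  unfold exchange
  rw [div_mul_cancel₀ _ (exchange_denom_pos a p q ω hω).ne', inner_sub_right, inner_smul_right,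
    inner_smul_right]
  field_simp

theorem energy_add_smul_sq (a : ℝ) (p ω : Mom) (hω : ‖ω‖ = 1) (s : ℝ) :
    energy a (p + s • ω) ^ 2 = energy a p ^ 2 + a ^ 2 * (2 * s * inner ℝ ω p + s ^ 2) := by
  rw [energy_sq, energy_sq, norm_add_sq_real, norm_smul, hω, inner_smul_right, real_inner_comm,
    mul_one, Real.norm_eq_abs, sq_abs]
  ring

theorem inner_add_smul_self (p ω : Mom) (hω : ‖ω‖ = 1) (s : ℝ) :
    inner ℝ ω (p + s • ω) = inner ℝ ω p + s := by
  rw [inner_add_right, inner_smul_right, real_inner_self_eq_norm_sq, hω]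
  ring

theorem postP_add_postQ (a : ℝ) (p q ω : Mom) : postP a p q ω + postQ a p q ω = p + q := by
  simp only [postP, postQ]; abel

theorem totalEnergy_post (a : ℝ) (p q ω : Mom) (hω : ‖ω‖ = 1) :
    totalEnergy a (postP a p q ω) (postQ a p q ω) = totalEnergy a p q :=
  energy_conservation a p q ω hω

/-- The denominator of `exchange` depends only on `ω` and the total energy and momentum, which are
conserved, so the claim is that the numerator changes sign. This makes the collision map an
involution for fixed `ω`. -/
theorem exchange_post (a : ℝ) (p q ω : Mom) (hω : ‖ω‖ = 1) :
    exchange a (postP a p q ω) (postQ a p q ω) ω = -exchange a p q ω := by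
  have hD := exchange_denom_pos a p q ω hω
  have h1 := exchange_mul_denom a p q ω hω
  have h2 := exchange_mul_denom a (postP a p q ω) (postQ a p q ω) ω hω
  have he := totalEnergy_post a p q ω hω
  rw [he, postP_add_postQ] at h2
  refine mul_right_cancel₀ hD.ne' ?_
  rw [h2, neg_mul, h1]
  have sP : energy a (postP a p q ω) ^ 2 = _ := energy_add_smul_sq a p ω hω (exchange a p q ω)
  have sQ : energy a (postQ a p q ω) ^ 2 = energy a q ^ 2
      + a ^ 2 * (2 * (-exchange a p q ω) * inner ℝ ω q + (-exchange a p q ω) ^ 2) := by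
    rw [← energy_add_smul_sq a q ω hω, neg_smul, ← sub_eq_add_neg]; rfl
  have iP : inner ℝ ω (postP a p q ω) = _ := inner_add_smul_self p ω hω (exchange a p q ω)
  have iQ : inner ℝ ω (postQ a p q ω) = inner ℝ ω q + -exchange a p q ω := by
    rw [← inner_add_smul_self q ω hω, neg_smul, ← sub_eq_add_neg]; rfl
  rw [iP, iQ]
  rw [inner_add_right] at h1
  unfold totalEnergy at he h1 ⊢
  have hP := energy_pos a p
  have hQ := energy_pos a q
  generalize exchange a p q ω = b at *
  generalize energy a (postP a p q ω) = P' at *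
  generalize energy a (postQ a p q ω) = Q' at *
  generalize energy a p = P at *
  generalize energy a q = Q at *
  generalize (inner ℝ ω p : ℝ) = x at *
  generalize (inner ℝ ω q : ℝ) = y at *
  -- The energy transferred to the first particle: subtract the two mass-shell relations and divide
  -- by twice the total energy.
  have hc : (P + Q) * (P' - P) = a ^ 2 * b * (x + y) := by
    linear_combination (1 / 2) * sP - (1 / 2) * sQ + (1 / 2) * (P - Q - P' + Q') * he + Q * he
  have hQ' : Q' = P + Q - P' := by linarith
  subst hQ'
  linear_combination 2 * (x + y) * hc - 2 * h1

/-! ### The collision map on a line parallel to `ω` -/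

/-- The collision map restricted to a line parallel to `ω`, on which `p + q` is constant. -/
def lineMap (a : ℝ) (p q ω : Mom) (s : ℝ) : ℝ := s + exchange a (p + s • ω) (q - s • ω) ω

theorem postP_line (a : ℝ) (p q ω : Mom) (s : ℝ) :
    postP a (p + s • ω) (q - s • ω) ω = p + lineMap a p q ω s • ω := by
  rw [postP, lineMap, add_smul, add_assoc]

theorem postQ_line (a : ℝ) (p q ω : Mom) (s : ℝ) :
    postQ a (p + s • ω) (q - s • ω) ω = q - lineMap a p q ω s • ω := by
  rw [postQ, lineMap, add_smul, sub_sub]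

theorem exchange_lineMap (a : ℝ) (p q ω : Mom) (hω : ‖ω‖ = 1) (s : ℝ) :
    exchange a (p + lineMap a p q ω s • ω) (q - lineMap a p q ω s • ω) ω
      = -exchange a (p + s • ω) (q - s • ω) ω := by
  rw [← postP_line, ← postQ_line, exchange_post _ _ _ _ hω]

theorem lineMap_lineMap (a : ℝ) (p q ω : Mom) (hω : ‖ω‖ = 1) (s : ℝ) :
    lineMap a p q ω (lineMap a p q ω s) = s := by
  rw [lineMap, exchange_lineMap a p q ω hω, lineMap]
  ring

theorem hasDerivAt_energy_line (a : ℝ) (p ω : Mom) (hω : ‖ω‖ = 1) (s : ℝ) :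
    HasDerivAt (fun s => energy a (p + s • ω))
      (a ^ 2 * inner ℝ ω (p + s • ω) / energy a (p + s • ω)) s := by
  have h : (fun s => energy a (p + s • ω))
      = fun s => √(energy a p ^ 2 + a ^ 2 * (2 * s * inner ℝ ω p + s ^ 2)) := by
    ext s
    rw [← energy_add_smul_sq a p ω hω, Real.sqrt_sq (energy_pos _ _).le]
  have hE : √(energy a p ^ 2 + a ^ 2 * (2 * s * inner ℝ ω p + s ^ 2)) = energy a (p + s • ω) := by
    rw [← energy_add_smul_sq a p ω hω, Real.sqrt_sq (energy_pos _ _).le]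
  rw [h]
  have hd : HasDerivAt (fun s : ℝ => energy a p ^ 2 + a ^ 2 * (2 * s * inner ℝ ω p + s ^ 2))
      (a ^ 2 * (2 * 1 * inner ℝ ω p + 2 * s)) s := by
    have := ((((hasDerivAt_id s).const_mul 2).mul_const (inner ℝ ω p)).add
      (hasDerivAt_pow 2 s)).const_mul (a ^ 2) |>.const_add (energy a p ^ 2)
    simpa using this
  have := hd.sqrt (by
    rw [← energy_add_smul_sq a p ω hω]
    exact (pow_pos (energy_pos _ _) 2).ne')
  convert! this using 1
  rw [hE, inner_add_smul_self p ω hω]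
  have := energy_pos a (p + s • ω)
  field_simp

theorem hasDerivAt_energy_line_neg (a : ℝ) (q ω : Mom) (hω : ‖ω‖ = 1) (s : ℝ) :
    HasDerivAt (fun s => energy a (q - s • ω))
      (-(a ^ 2 * inner ℝ ω (q - s • ω) / energy a (q - s • ω))) s := by
  have h := hasDerivAt_energy_line a q (-ω) (by simpa using hω) s
  simpa only [smul_neg, ← sub_eq_add_neg, inner_neg_left, mul_neg, neg_div] using h

theorem differentiable_lineMap (a : ℝ) (p q ω : Mom) (hω : ‖ω‖ = 1) :
    Differentiable ℝ (lineMap a p q ω) := by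
  have hE : Differentiable ℝ fun s => energy a (p + s • ω) :=
    fun s => (hasDerivAt_energy_line a p ω hω s).differentiableAt
  have hF : Differentiable ℝ fun s => energy a (q - s • ω) :=
    fun s => (hasDerivAt_energy_line_neg a q ω hω s).differentiableAt
  -- Since `p + q` is constant along the line, the momentum part of the denominator does not depend
  -- on `s`.
  have h : lineMap a p q ω = fun s => s + 2 * totalEnergy a (p + s • ω) (q - s • ω)
      * (energy a (p + s • ω) * inner ℝ ω (q - s • ω)
        - energy a (q - s • ω) * inner ℝ ω (p + s • ω))
      / (totalEnergy a (p + s • ω) (q - s • ω) ^ 2 - a ^ 2 * inner ℝ ω (p + q) ^ 2) := by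
    ext s
    have h1 := exchange_denom_pos a (p + s • ω) (q - s • ω) ω hω
    have h2 := exchange_mul_denom a (p + s • ω) (q - s • ω) ω hω
    rw [show p + s • ω + (q - s • ω) = p + q by abel] at h1 h2
    rw [lineMap, ← h2, mul_div_cancel_right₀ _ h1.ne']
  rw [h]
  unfold totalEnergy
  have i1 : Differentiable ℝ fun s : ℝ => (inner ℝ ω (q - s • ω) : ℝ) := by
    simp only [inner_sub_right, inner_smul_right]; fun_prop
  have i2 : Differentiable ℝ fun s : ℝ => (inner ℝ ω (p + s • ω) : ℝ) := by
    simp only [inner_add_right, inner_smul_right]; fun_prop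
  refine differentiable_id.add (Differentiable.div (by fun_prop) (by fun_prop) fun s => ?_)
  have h1 := exchange_denom_pos a (p + s • ω) (q - s • ω) ω hω
  rw [show p + s • ω + (q - s • ω) = p + q by abel] at h1
  exact h1.ne'

/-- Write `E`, `F` for the energies at `s`, `X`, `Y` for the components along `ω`, and primes for
values at the image point. The total energy has derivative `-a² N / (E F)`, where `N = E Y - F X` is
proportional to `exchange`. Differentiating its invariance under `lineMap` gives `σ' N' / (E' F') =
N / (E F)`, with `σ'` the derivative sought. As `exchange` changes sign, `N' = -N`, and `N ≠ 0` can
be cancelled. -/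
theorem deriv_lineMap {a : ℝ} (ha : a ≠ 0) (p q ω : Mom) (hω : ‖ω‖ = 1) (s : ℝ)
    (hs : exchange a (p + s • ω) (q - s • ω) ω ≠ 0) :
    deriv (lineMap a p q ω) s
      = -(energy a (p + lineMap a p q ω s • ω) * energy a (q - lineMap a p q ω s • ω)
        / (energy a (p + s • ω) * energy a (q - s • ω))) := by
  have hσ := (differentiable_lineMap a p q ω hω s).hasDerivAt
  set d := deriv (lineMap a p q ω) s
  set t := lineMap a p q ω s with ht
  have hφ := fun s => (hasDerivAt_energy_line a p ω hω s).add (hasDerivAt_energy_line_neg a q ω hω s)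
  have hcomp := (hφ t).comp s hσ
  have hsame : ((fun s => energy a (p + s • ω)) + fun s => energy a (q - s • ω)) ∘ lineMap a p q ω
      = (fun s => energy a (p + s • ω)) + fun s => energy a (q - s • ω) := by
    ext s
    have := energy_conservation a (p + s • ω) (q - s • ω) ω hω
    rwa [postP_line, postQ_line] at this
  rw [hsame] at hcomp
  have hd := hcomp.unique (hφ s)
  have b1 := exchange_mul_denom a (p + s • ω) (q - s • ω) ω hω
  have b2 := exchange_mul_denom a (p + t • ω) (q - t • ω) ω hω
  rw [exchange_lineMap a p q ω hω s] at b2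
  have hte : totalEnergy a (p + t • ω) (q - t • ω) = totalEnergy a (p + s • ω) (q - s • ω) := by
    have := totalEnergy_post a (p + s • ω) (q - s • ω) ω hω
    rwa [postP_line, postQ_line] at this
  have hD := exchange_denom_pos a (p + s • ω) (q - s • ω) ω hω
  rw [hte, show p + t • ω + (q - t • ω) = p + s • ω + (q - s • ω) by abel] at b2
  have he : 0 < totalEnergy a (p + s • ω) (q - s • ω) := add_pos (energy_pos _ _) (energy_pos _ _)
  have p1 := energy_pos a (p + s • ω)
  have p2 := energy_pos a (q - s • ω)
  have p3 := energy_pos a (p + t • ω)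
  have p4 := energy_pos a (q - t • ω)
  generalize totalEnergy a (p + s • ω) (q - s • ω) = e at *
  generalize e ^ 2 - a ^ 2 * inner ℝ ω (p + s • ω + (q - s • ω)) ^ 2 = D at *
  generalize exchange a (p + s • ω) (q - s • ω) ω = b at *
  generalize energy a (p + s • ω) = E at *
  generalize energy a (q - s • ω) = F at *
  generalize energy a (p + t • ω) = E' at *
  generalize energy a (q - t • ω) = F' at *
  generalize (inner ℝ ω (p + s • ω) : ℝ) = X at *
  generalize (inner ℝ ω (q - s • ω) : ℝ) = Y at *
  generalize (inner ℝ ω (p + t • ω) : ℝ) = X' at *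
  generalize (inner ℝ ω (q - t • ω) : ℝ) = Y' at *
  have hN : E * Y - F * X ≠ 0 := by
    intro h0
    rw [h0, mul_zero] at b1
    exact (mul_ne_zero hs hD.ne') b1
  have hN' : E' * Y' - F' * X' = -(E * Y - F * X) := by
    have : 2 * e * (E' * Y' - F' * X' + (E * Y - F * X)) = 0 := by linear_combination -b1 - b2
    have := (mul_eq_zero.1 this).resolve_left (by positivity)
    linarith
  field_simp at hd
  rw [eq_neg_iff_add_eq_zero, ← sub_neg_eq_add, sub_eq_zero, eq_comm, neg_eq_iff_eq_neg]
  rw [div_eq_iff (by positivity)]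
  have : (E * Y - F * X) * (d * (E * F) + E' * F') = 0 := by
    linear_combination hd + d * E * F * hN'
  have := (mul_eq_zero.1 this).resolve_left hN
  linarith

/-- No exchange means equal velocity components along `ω`. With the transverse energies `m` and `n`
fixed on the line, this becomes an equation linear in `s` with nonzero slope. -/
theorem subsingleton_exchange_eq_zero (a : ℝ) (p q ω : Mom) (hω : ‖ω‖ = 1) :
    {s : ℝ | exchange a (p + s • ω) (q - s • ω) ω = 0}.Subsingleton := by
  have hm : ∀ v : Mom, 0 < 1 + a ^ 2 * (‖v‖ ^ 2 - inner ℝ ω v ^ 2) := by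
    intro v
    have h : (inner ℝ ω v : ℝ) ^ 2 ≤ ‖v‖ ^ 2 := by
      have := abs_real_inner_le_norm ω v
      rw [hω, one_mul] at this
      exact sq_le_sq' (abs_le.1 this).1 (abs_le.1 this).2
    nlinarith [mul_nonneg (sq_nonneg a) (sub_nonneg.2 h)]
  -- The part of each energy due to mass and to momentum orthogonal to `ω`; it is unchanged by
  -- motion along `ω`.
  set m := √(1 + a ^ 2 * (‖p‖ ^ 2 - inner ℝ ω p ^ 2)) with hm1
  set n := √(1 + a ^ 2 * (‖q‖ ^ 2 - inner ℝ ω q ^ 2)) with hn1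
  have hm0 : 0 < m := Real.sqrt_pos.2 (hm p)
  have hn0 : 0 < n := Real.sqrt_pos.2 (hm q)
  have hms : m ^ 2 = _ := Real.sq_sqrt (hm p).le
  have hns : n ^ 2 = _ := Real.sq_sqrt (hm q).le
  have key : ∀ s : ℝ, exchange a (p + s • ω) (q - s • ω) ω = 0 →
      n * (inner ℝ ω p + s) = m * (inner ℝ ω q - s) := by
    intro s hs
    have b1 := exchange_mul_denom a (p + s • ω) (q - s • ω) ω hω
    have he : 0 < totalEnergy a (p + s • ω) (q - s • ω) :=
      add_pos (energy_pos _ _) (energy_pos _ _)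
    rw [hs, zero_mul, zero_eq_mul, or_iff_right (by positivity)] at b1
    have sE := energy_add_smul_sq a p ω hω s
    have sF := energy_add_smul_sq a q ω hω (-s)
    have iQ := inner_add_smul_self q ω hω (-s)
    rw [neg_smul, ← sub_eq_add_neg] at sF iQ
    rw [inner_add_smul_self p ω hω, iQ] at b1
    rw [energy_sq] at sE sF
    have hE := energy_pos a (p + s • ω)
    have hF := energy_pos a (q - s • ω)
    rw [← energy_sq] at sE sF
    have eP := energy_sq a p
    have eQ := energy_sq a q
    generalize energy a (p + s • ω) = E at *
    generalize energy a (q - s • ω) = F at *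
    generalize (inner ℝ ω p : ℝ) = x at *
    generalize (inner ℝ ω q : ℝ) = y at *
    have hE2 : E ^ 2 = m ^ 2 + a ^ 2 * (x + s) ^ 2 := by linear_combination sE + eP - hms
    have hF2 : F ^ 2 = n ^ 2 + a ^ 2 * (y - s) ^ 2 := by linear_combination sF + eQ - hns
    have hsq : (n * (x + s)) ^ 2 = (m * (y - s)) ^ 2 := by
      linear_combination -(x + s) ^ 2 * hF2 + (y - s) ^ 2 * hE2
        - (E * (y - s) + F * (x + s)) * b1
    rcases sq_eq_sq_iff_eq_or_eq_neg.1 hsq with h | h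
    · exact h
    -- Equal velocities have equal signs, so the opposite sign is possible only when both components
    -- vanish.
    · have hx : (x + s) * (F * m + E * n) = 0 := by linear_combination E * h - m * b1
      have hx0 := (mul_eq_zero.1 hx).resolve_right (by positivity)
      rw [hx0] at h ⊢
      linarith
  intro s hs t ht
  have h1 := key s hs
  have h2 := key t ht
  have : (n + m) * (s - t) = 0 := by linear_combination h1 - h2
  have := (mul_eq_zero.1 this).resolve_left (by positivity)
  linarith

/-- The density of the invariant measure `dp dq / (p⁰ q⁰)`. -/
def pairWeight (a : ℝ) (p q : Mom) : ENNReal := ENNReal.ofReal (1 / (energy a p * energy a q))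

/-- Off its fixed points, a null set, `lineMap` is a bijection, and its absolute derivative is
exactly the ratio of the pair weights at `s` and at its image. -/
theorem lintegral_line_collision {a : ℝ} (ha : a ≠ 0) (p q ω : Mom) (hω : ‖ω‖ = 1)
    (G : ℝ → ENNReal) :
    ∫⁻ s, G (lineMap a p q ω s) * pairWeight a (p + s • ω) (q - s • ω)
      = ∫⁻ s, G s * pairWeight a (p + s • ω) (q - s • ω) := by
  set Z := {s : ℝ | exchange a (p + s • ω) (q - s • ω) ω = 0} with hZ
  have hZs : Z.Subsingleton := subsingleton_exchange_eq_zero a p q ω hω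
  have hZm : MeasurableSet Zᶜ := hZs.measurableSet.compl
  have hZ0 : volume Z = 0 := hZs.countable.measure_zero _
  have hres : (volume : Measure ℝ).restrict Zᶜ = volume :=
    Measure.restrict_eq_self_of_ae_mem (compl_mem_ae_iff.2 hZ0)
  have hinv := lineMap_lineMap a p q ω hω
  have himage : lineMap a p q ω '' Zᶜ = Zᶜ := by
    have hmaps : ∀ s ∈ Zᶜ, lineMap a p q ω s ∈ Zᶜ := by
      intro s hs h
      rw [hZ, mem_ofPred_eq, exchange_lineMap a p q ω hω, neg_eq_zero] at h
      exact hs h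
    ext s
    constructor
    · rintro ⟨t, ht, rfl⟩
      exact hmaps t ht
    · exact fun hs => ⟨lineMap a p q ω s, hmaps s hs, hinv s⟩
  have h := lintegral_image_eq_lintegral_abs_deriv_mul hZm
    (fun s _ => (differentiable_lineMap a p q ω hω s).hasDerivAt.hasDerivWithinAt)
    (fun s _ t _ hst => by rw [← hinv s, hst, hinv t])
    (fun s => G s * pairWeight a (p + s • ω) (q - s • ω))
  rw [himage] at h
  rw [hres] at h
  rw [h, ← hres]
  refine setLIntegral_congr_fun hZm fun s hs => ?_
  rw [mul_left_comm, deriv_lineMap ha p q ω hω s hs, pairWeight, pairWeight,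
    ← ENNReal.ofReal_mul (abs_nonneg _), abs_neg]
  have p1 := energy_pos a (p + s • ω)
  have p2 := energy_pos a (q - s • ω)
  have p3 := energy_pos a (p + lineMap a p q ω s • ω)
  have p4 := energy_pos a (q - lineMap a p q ω s • ω)
  rw [abs_of_pos (by positivity)]
  congr 2
  field_simp

/-! ### From lines to pairs of momenta -/

/-- Integration over all lines parallel to the unit vector `ω`. -/
theorem lintegral_eq_lintegral_lines {ω : Mom} (hω : ‖ω‖ = 1) {G : Mom → ENNReal}
    (hG : Measurable G) :
    ∫⁻ p, G p = ∫⁻ p, (Ico (0 : ℝ) 1).indicator 1 (inner ℝ ω p) * ∫⁻ s : ℝ, G (p + s • ω) := by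
  have hk : Measurable ((Ico (0 : ℝ) 1).indicator (1 : ℝ → ENNReal)) :=
    measurable_one.indicator measurableSet_Ico
  -- The slab `0 ≤ ω · p < 1` normalizes the parametrization: translation along `ω` keeps a point in
  -- it for parameters of total length one. This replaces an orthogonal splitting of the space.
  have hunit : ∀ x : ℝ, ∫⁻ s, (Ico (0 : ℝ) 1).indicator (1 : ℝ → ENNReal) (x - s) = 1 := by
    intro x
    rw [lintegral_sub_left_eq_self, lintegral_indicator_one measurableSet_Ico]
    simp
  symm
  calc ∫⁻ p, (Ico (0 : ℝ) 1).indicator 1 (inner ℝ ω p) * ∫⁻ s : ℝ, G (p + s • ω)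
      = ∫⁻ p, ∫⁻ s : ℝ, (Ico (0 : ℝ) 1).indicator 1 (inner ℝ ω p) * G (p + s • ω) :=
        lintegral_congr fun p => (lintegral_const_mul _ (by fun_prop)).symm
    _ = ∫⁻ s : ℝ, ∫⁻ p, (Ico (0 : ℝ) 1).indicator 1 (inner ℝ ω p) * G (p + s • ω) :=
        lintegral_lintegral_swap (by fun_prop)
    _ = ∫⁻ s : ℝ, ∫⁻ p, (Ico (0 : ℝ) 1).indicator 1 (inner ℝ ω p - s) * G p := by
        refine lintegral_congr fun s => ?_
        rw [← lintegral_add_right_eq_self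
          (fun p => (Ico (0 : ℝ) 1).indicator 1 (inner ℝ ω p - s) * G p) (s • ω)]
        simp only [inner_add_smul_self _ ω hω, add_sub_cancel_right]
    _ = ∫⁻ p, ∫⁻ s : ℝ, (Ico (0 : ℝ) 1).indicator 1 (inner ℝ ω p - s) * G p :=
        lintegral_lintegral_swap (by fun_prop)
    _ = ∫⁻ p, G p := by
        refine lintegral_congr fun p => ?_
        rw [lintegral_mul_const _ (by fun_prop), hunit, one_mul]

@[fun_prop]
theorem measurable_energy (a : ℝ) : Measurable (energy a) := (continuous_energy a).measurable

@[fun_prop]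
theorem measurable_exchange {α : Type*} [MeasurableSpace α] (a : ℝ) {p q ω : α → Mom}
    (hp : Measurable p) (hq : Measurable q) (hω : Measurable ω) :
    Measurable fun x => exchange a (p x) (q x) (ω x) := by
  unfold exchange totalEnergy
  fun_prop

@[fun_prop]
theorem measurable_postP {α : Type*} [MeasurableSpace α] (a : ℝ) {p q ω : α → Mom}
    (hp : Measurable p) (hq : Measurable q) (hω : Measurable ω) :
    Measurable fun x => postP a (p x) (q x) (ω x) := by
  unfold postP
  fun_prop

@[fun_prop]
theorem measurable_postQ {α : Type*} [MeasurableSpace α] (a : ℝ) {p q ω : α → Mom}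
    (hp : Measurable p) (hq : Measurable q) (hω : Measurable ω) :
    Measurable fun x => postQ a (p x) (q x) (ω x) := by
  unfold postQ
  fun_prop

@[fun_prop]
theorem measurable_pairWeight {α : Type*} [MeasurableSpace α] (a : ℝ) {p q : α → Mom}
    (hp : Measurable p) (hq : Measurable q) :
    Measurable fun x => pairWeight a (p x) (q x) := by
  unfold pairWeight
  fun_prop

/-- The shear `k = p + q` preserves volume. For fixed `k` the collision moves only `p`, along `ω`,
so the integral over `p` is cut into lines. -/
theorem lintegral_lintegral_eq_lines {ω : Mom} (hω : ‖ω‖ = 1) {H : Mom × Mom → ENNReal}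
    (hH : Measurable H) :
    ∫⁻ p, ∫⁻ q, H (p, q) = ∫⁻ k : Mom, ∫⁻ p, (Ico (0 : ℝ) 1).indicator 1 (inner ℝ ω p)
      * ∫⁻ s : ℝ, H (p + s • ω, k - p - s • ω) := by
  calc ∫⁻ p, ∫⁻ q, H (p, q) = ∫⁻ p, ∫⁻ k, H (p, k - p) :=
        lintegral_congr fun p => (lintegral_sub_right_eq_self (fun q => H (p, q)) p).symm
    _ = ∫⁻ k, ∫⁻ p, H (p, k - p) := lintegral_lintegral_swap (by fun_prop)
    _ = _ := by
        refine lintegral_congr fun k => ?_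
        rw [lintegral_eq_lintegral_lines hω (G := fun p => H (p, k - p)) (by fun_prop)]
        simp only [sub_add_eq_sub_sub]

theorem lintegral_collision {a : ℝ} (ha : a ≠ 0) {ω : Mom} (hω : ‖ω‖ = 1)
    {F : Mom × Mom → ENNReal} (hF : Measurable F) :
    ∫⁻ p, ∫⁻ q, F (postP a p q ω, postQ a p q ω) * pairWeight a p q
      = ∫⁻ p, ∫⁻ q, F (p, q) * pairWeight a p q := by
  rw [lintegral_lintegral_eq_lines hω (H := fun x =>
      F (postP a x.1 x.2 ω, postQ a x.1 x.2 ω) * pairWeight a x.1 x.2) (by fun_prop),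
    lintegral_lintegral_eq_lines hω (H := fun x => F x * pairWeight a x.1 x.2) (by fun_prop)]
  refine lintegral_congr fun k => lintegral_congr fun p => ?_
  simp only [postP_line, postQ_line]
  rw [lintegral_line_collision ha p (k - p) ω hω fun s => F (p + s • ω, k - p - s • ω)]

/-! ### Estimates for the collision operator -/

/-- A map of pairs of momenta, depending on a unit vector, which conserves the energy and preserves
the measure `dp dq / (p⁰ q⁰)`. -/
structure IsTransition (a : ℝ) (Φ Ψ : Mom → Mom → Mom → Mom) : Prop where
  measurable_fst : Measurable fun x : Mom × Mom × Mom => Φ x.1 x.2.1 x.2.2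
  measurable_snd : Measurable fun x : Mom × Mom × Mom => Ψ x.1 x.2.1 x.2.2
  energy_eq : ∀ p q ω, ‖ω‖ = 1 →
    totalEnergy a (Φ p q ω) (Ψ p q ω) = totalEnergy a p q
  lintegral_eq : ∀ ω, ‖ω‖ = 1 → ∀ F : Mom × Mom → ENNReal, Measurable F →
    ∫⁻ p, ∫⁻ q, F (Φ p q ω, Ψ p q ω) * pairWeight a p q
      = ∫⁻ p, ∫⁻ q, F (p, q) * pairWeight a p q

theorem isTransition_post {a : ℝ} (ha : a ≠ 0) : IsTransition a (postP a) (postQ a) where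
  measurable_fst := by fun_prop
  measurable_snd := by fun_prop
  energy_eq p q ω hω := totalEnergy_post a p q ω hω
  lintegral_eq ω hω F hF := lintegral_collision ha hω hF

/-- With the identity transition the loss term has the same form as the gain term, so each estimate
is proved once for both. -/
theorem isTransition_id (a : ℝ) : IsTransition a (fun p _ _ => p) (fun _ q _ => q) where
  measurable_fst := by fun_prop
  measurable_snd := by fun_prop
  energy_eq p q ω hω := rfl
  lintegral_eq ω hω F hF := rfl

/-- The common form of the gain and the loss term. -/
def transitionTerm (a : ℝ) (Φ Ψ : Mom → Mom → Mom → Mom) (k : Mom → Mom → Mom → ℝ) (u v : Mom → ℝ)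
    (p : Mom) : ℝ :=
  ∫ q : Mom, a ^ 3 / energy a q * ∫ ω : S2, u (Φ p q ω) * v (Ψ p q ω) * k p q ω ∂sphereMeasure

/-- The integrand of `transitionTerm` on the space of pairs `(q, ω)`. -/
def transitionIntegrand (a : ℝ) (Φ Ψ : Mom → Mom → Mom → Mom) (k : Mom → Mom → Mom → ℝ)
    (u v : Mom → ℝ) (p : Mom) (x : Mom × S2) : ℝ :=
  a ^ 3 / energy a x.1 * (u (Φ p x.1 x.2) * v (Ψ p x.1 x.2) * k p x.1 x.2)

section Transition

variable {a : ℝ} {Φ Ψ : Mom → Mom → Mom → Mom} {k : Mom → Mom → Mom → ℝ}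

/-- The majorant of the gain and the loss term. -/
def transitionBound (a : ℝ) (Φ Ψ : Mom → Mom → Mom → Mom) (U V : Mom → ENNReal) (p : Mom) :
    ENNReal :=
  ∫⁻ x : Mom × S2, ENNReal.ofReal (a ^ 3 / energy a x.1) *
    (U (Φ p x.1 x.2) * V (Ψ p x.1 x.2)) ∂(volume.prod sphereMeasure)

theorem IsTransition.measurable_fst_comp {β : Type*} [MeasurableSpace β]
    (h : IsTransition a Φ Ψ) {U : Mom → β} (hU : Measurable U) :
    Measurable fun x : Mom × Mom × S2 => U (Φ x.1 x.2.1 x.2.2) :=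
  hU.comp (h.measurable_fst.comp
    (f := fun x : Mom × Mom × S2 => (x.1, x.2.1, (x.2.2 : Mom))) (by fun_prop))

theorem IsTransition.measurable_snd_comp {β : Type*} [MeasurableSpace β]
    (h : IsTransition a Φ Ψ) {U : Mom → β} (hU : Measurable U) :
    Measurable fun x : Mom × Mom × S2 => U (Ψ x.1 x.2.1 x.2.2) :=
  hU.comp (h.measurable_snd.comp
    (f := fun x : Mom × Mom × S2 => (x.1, x.2.1, (x.2.2 : Mom))) (by fun_prop))

theorem IsTransition.measurable_bound_integrand (h : IsTransition a Φ Ψ) {U V : Mom → ENNReal}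
    (hU : Measurable U) (hV : Measurable V) :
    Measurable fun x : Mom × Mom × S2 => ENNReal.ofReal (a ^ 3 / energy a x.2.1) *
      (U (Φ x.1 x.2.1 x.2.2) * V (Ψ x.1 x.2.1 x.2.2)) :=
  Measurable.mul (by fun_prop) ((h.measurable_fst_comp hU).mul (h.measurable_snd_comp hV))

theorem IsTransition.measurable_bound_integrand_right (h : IsTransition a Φ Ψ)
    {U V : Mom → ENNReal} (hU : Measurable U) (hV : Measurable V) (p : Mom) :
    Measurable fun x : Mom × S2 => ENNReal.ofReal (a ^ 3 / energy a x.1) *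
      (U (Φ p x.1 x.2) * V (Ψ p x.1 x.2)) := by
  have h1 := (h.measurable_bound_integrand hU hV).comp (measurable_prodMk_left (x := p))
  simpa only [Function.comp_def] using h1

theorem IsTransition.measurable_transitionBound (h : IsTransition a Φ Ψ) {U V : Mom → ENNReal}
    (hU : Measurable U) (hV : Measurable V) : Measurable (transitionBound a Φ Ψ U V) :=
  (h.measurable_bound_integrand hU hV).lintegral_prod_right'

theorem weight_le_energy (ha : 1 ≤ a) (p : Mom) : √(1 + ‖p‖ ^ 2) ≤ energy a p := by
  unfold energy
  gcongr
  exact le_mul_of_one_le_left (by positivity) (by nlinarith)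

theorem one_le_energy (a : ℝ) (p : Mom) : 1 ≤ energy a p := by
  rw [energy, Real.one_le_sqrt]
  have : 0 ≤ a ^ 2 * ‖p‖ ^ 2 := by positivity
  linarith

theorem totalEnergy_mul_pairWeight_le (a : ℝ) (p q : Mom) :
    ENNReal.ofReal (totalEnergy a p q) * pairWeight a p q ≤ 2 := by
  have hp := one_le_energy a p
  have hq := one_le_energy a q
  unfold totalEnergy pairWeight
  rw [← ENNReal.ofReal_mul (by linarith), ← ENNReal.ofReal_ofNat]
  refine ENNReal.ofReal_le_ofReal ?_
  rw [mul_one_div, div_le_iff₀ (by positivity)]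
  nlinarith

/-- The weight at `p` is at most `p⁰`, hence at most the total energy, which the transition
conserves. The integrand thus becomes a function of the transformed pair, and invariance of `dp dq /
(p⁰ q⁰)` removes the transition. Finally `(p⁰ + q⁰) / (p⁰ q⁰) ≤ 2` leaves a product of unweighted
`L¹` norms. -/
theorem IsTransition.lintegral_transitionBound_le (h : IsTransition a Φ Ψ) (ha : 1 ≤ a)
    {U V : Mom → ENNReal} (hU : Measurable U) (hV : Measurable V) :
    ∫⁻ p, ENNReal.ofReal (√(1 + ‖p‖ ^ 2)) * (ENNReal.ofReal (1 / energy a p)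
        * transitionBound a Φ Ψ U V p)
      ≤ ENNReal.ofReal (a ^ 3) * sphereMeasure univ * 2 * ((∫⁻ p, U p) * ∫⁻ p, V p) := by
  have ha3 : 0 ≤ a ^ 3 := by positivity
  set H : Mom × Mom → ENNReal := fun z => ENNReal.ofReal (totalEnergy a z.1 z.2) * (U z.1 * V z.2)
    with hH
  have hHm : Measurable H := by
    unfold H totalEnergy
    fun_prop
  have hHm' : Measurable fun x : Mom × Mom × S2 =>
      H (Φ x.1 x.2.1 x.2.2, Ψ x.1 x.2.1 x.2.2) * pairWeight a x.1 x.2.1 := by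
    refine Measurable.mul (hHm.comp ?_) (by fun_prop)
    exact (h.measurable_fst_comp measurable_id).prodMk (h.measurable_snd_comp measurable_id)
  calc ∫⁻ p, ENNReal.ofReal (√(1 + ‖p‖ ^ 2)) * (ENNReal.ofReal (1 / energy a p)
        * transitionBound a Φ Ψ U V p)
      ≤ ∫⁻ p, ENNReal.ofReal (a ^ 3) * ∫⁻ x : Mom × S2,
          H (Φ p x.1 x.2, Ψ p x.1 x.2) * pairWeight a p x.1 ∂(volume.prod sphereMeasure) := by
        refine lintegral_mono fun p => ?_
        rw [← mul_assoc, transitionBound, ← lintegral_const_mul' _ _ (by finiteness),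
          ← lintegral_const_mul' _ _ (by finiteness)]
        refine lintegral_mono fun x => ?_
        have e1 := one_le_energy a p
        have e2 := one_le_energy a x.1
        have hw := weight_le_energy ha p
        have hω : ‖(x.2 : Mom)‖ = 1 := norm_eq_of_mem_sphere x.2
        simp only [hH, h.energy_eq p x.1 x.2 hω]
        have hle : ENNReal.ofReal √(1 + ‖p‖ ^ 2) * ENNReal.ofReal (1 / energy a p)
              * ENNReal.ofReal (a ^ 3 / energy a x.1)
            ≤ ENNReal.ofReal (a ^ 3) * (ENNReal.ofReal (totalEnergy a p x.1)
              * pairWeight a p x.1) := by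
          rw [totalEnergy, pairWeight, ← ENNReal.ofReal_mul (Real.sqrt_nonneg _),
            ← ENNReal.ofReal_mul (by positivity),
            ← ENNReal.ofReal_mul (add_pos (energy_pos a p) (energy_pos a x.1)).le,
            ← ENNReal.ofReal_mul ha3]
          refine ENNReal.ofReal_le_ofReal ?_
          have : √(1 + ‖p‖ ^ 2) ≤ energy a p + energy a x.1 := by linarith
          calc √(1 + ‖p‖ ^ 2) * (1 / energy a p) * (a ^ 3 / energy a x.1)
              = a ^ 3 * (√(1 + ‖p‖ ^ 2) * (1 / (energy a p * energy a x.1))) := by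
                field_simp
            _ ≤ _ := by gcongr
        calc _ = (ENNReal.ofReal √(1 + ‖p‖ ^ 2) * ENNReal.ofReal (1 / energy a p)
              * ENNReal.ofReal (a ^ 3 / energy a x.1)) * (U (Φ p x.1 x.2) * V (Ψ p x.1 x.2)) :=
              (mul_assoc _ _ _).symm
          _ ≤ _ := mul_le_mul_left hle _
          _ = _ := by ring
    _ = ENNReal.ofReal (a ^ 3) * ∫⁻ ω : S2, (∫⁻ p, ∫⁻ q,
          H (Φ p q ω, Ψ p q ω) * pairWeight a p q) ∂sphereMeasure := by
        rw [lintegral_const_mul _ hHm'.lintegral_prod_right']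
        congr 1
        -- The sphere variable is moved outermost, because invariance of the measure is available
        -- for each fixed `ω`.
        have hsw : ∀ p, ∫⁻ x : Mom × S2,
            H (Φ p x.1 x.2, Ψ p x.1 x.2) * pairWeight a p x.1 ∂(volume.prod sphereMeasure)
            = ∫⁻ ω : S2, (∫⁻ q, H (Φ p q ω, Ψ p q ω) * pairWeight a p q) ∂sphereMeasure := by
          intro p
          have hm : Measurable fun x : Mom × S2 =>
              H (Φ p x.1 x.2, Ψ p x.1 x.2) * pairWeight a p x.1 := by
            have h1 := hHm'.comp (measurable_prodMk_left (x := p))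
            simpa only [Function.comp_def] using h1
          exact lintegral_prod_symm' _ hm
        simp only [hsw]
        refine lintegral_lintegral_swap (Measurable.aemeasurable ?_)
        exact Measurable.lintegral_prod_right' (f := fun y : (Mom × S2) × Mom =>
          H (Φ y.1.1 y.2 y.1.2, Ψ y.1.1 y.2 y.1.2) * pairWeight a y.1.1 y.2)
          (hHm'.comp (f := fun y : (Mom × S2) × Mom => (y.1.1, y.2, y.1.2)) (by fun_prop))
    _ = ENNReal.ofReal (a ^ 3) * ∫⁻ _ω : S2, (∫⁻ p, ∫⁻ q,
          H (p, q) * pairWeight a p q) ∂sphereMeasure := by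
        congr 1
        exact lintegral_congr fun ω => h.lintegral_eq ω (norm_eq_of_mem_sphere ω) H hHm
    _ ≤ ENNReal.ofReal (a ^ 3) * ∫⁻ _ω : S2, 2 * ((∫⁻ p, U p) * ∫⁻ p, V p) ∂sphereMeasure := by
        gcongr
        calc ∫⁻ p, ∫⁻ q, H (p, q) * pairWeight a p q
            ≤ ∫⁻ p, ∫⁻ q, 2 * (U p * V q) := by
              refine lintegral_mono fun p => lintegral_mono fun q => ?_
              calc H (p, q) * pairWeight a p q
                  = ENNReal.ofReal (totalEnergy a p q) * pairWeight a p q * (U p * V q) := by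
                    simp only [hH]; ring
                _ ≤ _ := mul_le_mul_left (totalEnergy_mul_pairWeight_le a p q) _
          _ = _ := by
              simp_rw [lintegral_const_mul 2 (hV.const_mul _), lintegral_const_mul _ hV]
              rw [lintegral_const_mul 2 (hU.mul_const _), lintegral_mul_const _ hU]
    _ = _ := by
        rw [lintegral_const]
        ring

theorem enorm_transitionIntegrand_le {C : ℝ} (ha : 0 ≤ a) (hk : ∀ p q ω, |k p q ω| ≤ C)
    (u v : Mom → ℝ)
    (p : Mom) (x : Mom × S2) :
    ‖transitionIntegrand a Φ Ψ k u v p x‖ₑ ≤ ENNReal.ofReal C *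
      (ENNReal.ofReal (a ^ 3 / energy a x.1) * (‖u (Φ p x.1 x.2)‖ₑ * ‖v (Ψ p x.1 x.2)‖ₑ)) := by
  have h1 : ‖k p x.1 x.2‖ₑ ≤ ENNReal.ofReal C := by
    rw [Real.enorm_eq_ofReal_abs]
    exact ENNReal.ofReal_le_ofReal (hk _ _ _)
  have h2 : ‖a ^ 3 / energy a x.1‖ₑ = ENNReal.ofReal (a ^ 3 / energy a x.1) :=
    Real.enorm_of_nonneg (div_nonneg (by positivity) (energy_pos _ _).le)
  rw [transitionIntegrand, enorm_mul, enorm_mul, enorm_mul, h2]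
  calc _ ≤ ENNReal.ofReal (a ^ 3 / energy a x.1) *
        (‖u (Φ p x.1 x.2)‖ₑ * ‖v (Ψ p x.1 x.2)‖ₑ * ENNReal.ofReal C) := by gcongr
    _ = _ := by ring

theorem IsTransition.measurable_transitionIntegrand (h : IsTransition a Φ Ψ)
    (hk : Measurable fun x : Mom × Mom × Mom => k x.1 x.2.1 x.2.2) {u v : Mom → ℝ}
    (hu : Measurable u) (hv : Measurable v) (p : Mom) :
    Measurable (transitionIntegrand a Φ Ψ k u v p) := by
  have hk' : Measurable fun x : Mom × S2 => k p x.1 x.2 :=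
    hk.comp (f := fun x : Mom × S2 => (p, x.1, (x.2 : Mom))) (by fun_prop)
  have h1 := (h.measurable_fst_comp hu).comp (measurable_prodMk_left (x := p))
  have h2 := (h.measurable_snd_comp hv).comp (measurable_prodMk_left (x := p))
  exact Measurable.mul (by fun_prop) ((h1.mul h2).mul hk')

/-- The weighted integral is finite and its weights are nonzero, so the majorant can be infinite
only on a null set. This is what makes the collision integrals converge for almost every `p`. -/
theorem IsTransition.ae_transitionBound_lt_top (h : IsTransition a Φ Ψ) (ha : 1 ≤ a)
    {U V : Mom → ENNReal} (hU : Measurable U) (hV : Measurable V)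
    (hUi : ∫⁻ p, U p ≠ ⊤) (hVi : ∫⁻ p, V p ≠ ⊤) :
    ∀ᵐ p, transitionBound a Φ Ψ U V p < ⊤ := by
  have hm := h.measurable_transitionBound hU hV
  have hfin := ae_lt_top (μ := volume) (f := fun p : Mom => ENNReal.ofReal (√(1 + ‖p‖ ^ 2)) *
    (ENNReal.ofReal (1 / energy a p) * transitionBound a Φ Ψ U V p)) (by fun_prop)
    (ne_top_of_le_ne_top (by finiteness) (h.lintegral_transitionBound_le ha hU hV))
  filter_upwards [hfin] with p hp
  by_contra htop
  have h1 : ENNReal.ofReal (√(1 + ‖p‖ ^ 2)) ≠ 0 := by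
    simpa using (zero_lt_one.trans_le (one_le_weight p))
  have h2 : ENNReal.ofReal (1 / energy a p) ≠ 0 := by
    simpa using energy_pos a p
  rw [not_lt_top_iff.1 htop, ENNReal.mul_top h2, ENNReal.mul_top h1] at hp
  exact lt_irrefl _ hp

/-- Bochner integrals may be subtracted only where they converge. Passing to one absolutely
convergent integral over pairs `(q, ω)` makes the later bilinear splitting legitimate. -/
theorem IsTransition.ae_transitionTerm_eq (h : IsTransition a Φ Ψ) (ha : 1 ≤ a) {C : ℝ}
    (hk : Measurable fun x : Mom × Mom × Mom => k x.1 x.2.1 x.2.2)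
    (hkC : ∀ p q ω, |k p q ω| ≤ C) {u v : Mom → ℝ} (hu : Measurable u) (hv : Measurable v)
    (hui : ∫⁻ p, ‖u p‖ₑ ≠ ⊤) (hvi : ∫⁻ p, ‖v p‖ₑ ≠ ⊤) :
    ∀ᵐ p, Integrable (transitionIntegrand a Φ Ψ k u v p) (volume.prod sphereMeasure) ∧
      transitionTerm a Φ Ψ k u v p
        = ∫ x, transitionIntegrand a Φ Ψ k u v p x ∂(volume.prod sphereMeasure) := by
  filter_upwards [h.ae_transitionBound_lt_top ha hu.enorm hv.enorm hui hvi] with p hp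
  have hint : Integrable (transitionIntegrand a Φ Ψ k u v p) (volume.prod sphereMeasure) := by
    refine ⟨(h.measurable_transitionIntegrand hk hu hv p).aestronglyMeasurable, ?_⟩
    refine (lintegral_mono fun x =>
      enorm_transitionIntegrand_le (by linarith) hkC u v p x).trans_lt ?_
    rw [lintegral_const_mul' _ _ ENNReal.ofReal_ne_top]
    exact ENNReal.mul_lt_top ENNReal.ofReal_lt_top hp
  refine ⟨hint, ?_⟩
  rw [integral_prod _ hint]
  unfold transitionTerm transitionIntegrand
  simp only [integral_const_mul]

theorem IsTransition.ae_enorm_transitionTerm_sub_le (h : IsTransition a Φ Ψ) (ha : 1 ≤ a) {C : ℝ}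
    (hk : Measurable fun x : Mom × Mom × Mom => k x.1 x.2.1 x.2.2)
    (hkC : ∀ p q ω, |k p q ω| ≤ C) {u v : Mom → ℝ} (hu : Measurable u) (hv : Measurable v)
    (hui : ∫⁻ p, ‖u p‖ₑ ≠ ⊤) (hvi : ∫⁻ p, ‖v p‖ₑ ≠ ⊤) :
    ∀ᵐ p, ‖transitionTerm a Φ Ψ k u u p - transitionTerm a Φ Ψ k v v p‖ₑ
      ≤ ENNReal.ofReal C * (transitionBound a Φ Ψ (fun p => ‖u p‖ₑ) (fun p => ‖u p - v p‖ₑ) p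
        + transitionBound a Φ Ψ (fun p => ‖u p - v p‖ₑ) (fun p => ‖v p‖ₑ) p) := by
  filter_upwards [h.ae_transitionTerm_eq ha hk hkC hu hu hui hui,
    h.ae_transitionTerm_eq ha hk hkC hv hv hvi hvi] with p hp1 hp2
  rw [hp1.2, hp2.2, ← integral_sub hp1.1 hp2.1]
  refine (enorm_integral_le_lintegral_enorm _).trans ?_
  have hm := h.measurable_bound_integrand_right hu.enorm (hu.sub hv).enorm p
  unfold transitionBound
  have hadd := lintegral_add_left (μ := volume.prod sphereMeasure) hm (fun x : Mom × S2 =>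
    ENNReal.ofReal (a ^ 3 / energy a x.1) *
      (‖u (Φ p x.1 x.2) - v (Φ p x.1 x.2)‖ₑ * ‖v (Ψ p x.1 x.2)‖ₑ))
  refine le_of_le_of_eq ?_ (congrArg (ENNReal.ofReal C * ·) hadd)
  beta_reduce
  rw [← lintegral_const_mul' _ _ ENNReal.ofReal_ne_top]
  refine lintegral_mono fun x => ?_
  -- Bilinearity: `u u - v v = u (u - v) + (u - v) v`.
  have hsplit : transitionIntegrand a Φ Ψ k u u p x - transitionIntegrand a Φ Ψ k v v p x
      = transitionIntegrand a Φ Ψ k u (fun p => u p - v p) p x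
        + transitionIntegrand a Φ Ψ k (fun p => u p - v p) v p x := by
    simp only [transitionIntegrand]; ring
  rw [hsplit, mul_add]
  refine (enorm_add_le _ _).trans (add_le_add ?_ ?_)
  · exact enorm_transitionIntegrand_le (by linarith) hkC _ _ p x
  · exact enorm_transitionIntegrand_le (by linarith) hkC _ _ p x

theorem IsTransition.lintegral_transitionBound_add_le (h : IsTransition a Φ Ψ) (ha : 1 ≤ a)
    (c : ENNReal) {U V W : Mom → ENNReal} (hU : Measurable U) (hV : Measurable V)
    (hW : Measurable W) :
    ∫⁻ p, ENNReal.ofReal (√(1 + ‖p‖ ^ 2)) * (ENNReal.ofReal (1 / energy a p)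
        * (c * (transitionBound a Φ Ψ U W p + transitionBound a Φ Ψ W V p)))
      ≤ c * (ENNReal.ofReal (a ^ 3) * sphereMeasure univ * 2) * ((∫⁻ p, U p) + ∫⁻ p, V p)
        * ∫⁻ p, W p := by
  have hb1 := h.measurable_transitionBound hU hW
  have hb2 := h.measurable_transitionBound hW hV
  calc _ = ∫⁻ p, c * (ENNReal.ofReal (√(1 + ‖p‖ ^ 2)) *
          (ENNReal.ofReal (1 / energy a p) * transitionBound a Φ Ψ U W p)
          + ENNReal.ofReal (√(1 + ‖p‖ ^ 2)) *
          (ENNReal.ofReal (1 / energy a p) * transitionBound a Φ Ψ W V p)) :=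
        lintegral_congr fun p => by ring
    _ ≤ c * (ENNReal.ofReal (a ^ 3) * sphereMeasure univ * 2 * ((∫⁻ p, U p) * ∫⁻ p, W p)
          + ENNReal.ofReal (a ^ 3) * sphereMeasure univ * 2 * ((∫⁻ p, W p) * ∫⁻ p, V p)) := by
        rw [lintegral_const_mul _ (by fun_prop), lintegral_add_left (by fun_prop)]
        gcongr
        · exact h.lintegral_transitionBound_le ha hU hW
        · exact h.lintegral_transitionBound_le ha hW hV
    _ = _ := by ring

end Transition

/-- The Lipschitz estimate from `L¹` to the weighted space; the outer factor `2` accounts for gain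
plus loss. -/
theorem lintegral_collision_sub_le {A : ℝ → Mom → Mom → Mom → Mom → ℝ} {C₁ γ : ℝ}
    (hA : IsCollisionKernel A C₁ γ) {a : ℝ} (ha : 1 ≤ a) {u v : Mom → ℝ}
    (hu : Measurable u) (hv : Measurable v)
    (hui : ∫⁻ p, ‖u p‖ₑ ≠ ⊤) (hvi : ∫⁻ p, ‖v p‖ₑ ≠ ⊤) :
    ∫⁻ p, ENNReal.ofReal (√(1 + ‖p‖ ^ 2)) * ‖1 / energy a p * collision A a u u p
        - 1 / energy a p * collision A a v v p‖ₑ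
      ≤ 2 * (ENNReal.ofReal C₁ * (ENNReal.ofReal (a ^ 3) * sphereMeasure univ * 2)
        * ((∫⁻ p, ‖u p‖ₑ) + ∫⁻ p, ‖v p‖ₑ) * ∫⁻ p, ‖u p - v p‖ₑ) := by
  have ha0 : 0 < a := by linarith
  set k : Mom → Mom → Mom → ℝ :=
    fun p q ω => A a p q (postP a p q ω) (postQ a p q ω)
  have hk : Measurable fun x : Mom × Mom × Mom => k x.1 x.2.1 x.2.2 :=
    (hA.measurable a ha0).comp (f := fun x : Mom × Mom × Mom =>
      (x.1, x.2.1, postP a x.1 x.2.1 x.2.2, postQ a x.1 x.2.1 x.2.2)) (by fun_prop)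
  have hkC : ∀ p q ω, |k p q ω| ≤ C₁ := fun p q ω => by
    rw [abs_of_nonneg (hA.nonneg a ha0 _ _ _ _)]
    exact hA.le_bound a ha0 _ _ _ _
  have hgain : ∀ u p, gain A a u u p = transitionTerm a (postP a) (postQ a) k u u p :=
    fun _ _ => rfl
  have hloss : ∀ u p, loss A a u u p = transitionTerm a (fun p _ _ => p) (fun _ q _ => q) k u u p :=
    fun _ _ => rfl
  have h1 := (isTransition_post ha0.ne').ae_enorm_transitionTerm_sub_le ha hk hkC hu hv hui hvi
  have h2 := (isTransition_id a).ae_enorm_transitionTerm_sub_le ha hk hkC hu hv hui hvi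
  have hw : Measurable fun p => ‖u p - v p‖ₑ := (hu.sub hv).enorm
  have i1 := (isTransition_post ha0.ne').lintegral_transitionBound_add_le ha (ENNReal.ofReal C₁)
    hu.enorm hv.enorm hw
  have i2 := (isTransition_id a).lintegral_transitionBound_add_le ha (ENNReal.ofReal C₁)
    hu.enorm hv.enorm hw
  have m1 := (isTransition_post ha0.ne').measurable_transitionBound hu.enorm hw
  have m2 := (isTransition_post ha0.ne').measurable_transitionBound hw hv.enorm
  rw [two_mul]
  refine le_trans ?_ (add_le_add i1 i2)
  rw [← lintegral_add_left (by fun_prop)]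
  refine lintegral_mono_ae ?_
  filter_upwards [h1, h2] with p hp1 hp2
  rw [← mul_add, ← mul_add, ← mul_sub, enorm_mul,
    Real.enorm_of_nonneg (one_div_pos.2 (energy_pos a p)).le]
  gcongr
  have : collision A a u u p - collision A a v v p
      = (gain A a u u p - gain A a v v p) - (loss A a u u p - loss A a v v p) := by
    unfold collision; ring
  rw [this]
  exact enorm_sub_le.trans (add_le_add hp1 hp2)

/-! ### Rotations of elements of `L¹₂` and uniqueness -/

theorem measurePreserving_weighted (R : Mom ≃ₗᵢ[ℝ] Mom) :
    MeasurePreserving R weightedMeasure weightedMeasure := by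
  have hR : Measurable R := R.continuous.measurable
  refine ⟨hR, Measure.ext fun s hs => ?_⟩
  rw [Measure.map_apply hR hs, weightedMeasure, withDensity_apply _ (hR hs),
    withDensity_apply _ hs]
  rw [← R.measurePreserving.setLIntegral_comp_preimage hs measurable_weight]
  simp

/-- The action of a linear isometry on `L¹₂`. -/
def rotateL12 (R : Mom ≃ₗᵢ[ℝ] Mom) : L12 →ₗᵢ[ℝ] L12 :=
  Lp.compMeasurePreservingₗᵢ ℝ R (measurePreserving_weighted R)

theorem coeFn_rotateL12 (R : Mom ≃ₗᵢ[ℝ] Mom) (u : L12) :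
    ∀ᵐ p : Mom, rotateL12 R u p = u (R p) :=
  ae_weightedMeasure_iff.1 (Lp.coeFn_compMeasurePreserving u (measurePreserving_weighted R))

theorem L12.enorm_eq (u : L12) :
    ‖u‖ₑ = ∫⁻ p : Mom, ENNReal.ofReal (√(1 + ‖p‖ ^ 2)) * ‖u p‖ₑ := by
  rw [Lp.enorm_def, eLpNorm_one_eq_lintegral_enorm]
  exact lintegral_withDensity_eq_lintegral_mul _ measurable_weight
    (Lp.stronglyMeasurable u).measurable.enorm

theorem L12.lintegral_enorm_le (u : L12) : ∫⁻ p : Mom, ‖u p‖ₑ ≤ ‖u‖ₑ := by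
  rw [L12.enorm_eq]
  refine lintegral_mono fun p => le_mul_of_one_le_left zero_le ?_
  rw [ENNReal.one_le_ofReal]
  exact one_le_weight p

/-- By equivariance, rotating `g` gives almost everywhere the collision term of `u ∘ R`, so the
Lipschitz estimate applies to the pair `u`, `u ∘ R`. -/
theorem enorm_sub_rotateL12_le {A : ℝ → Mom → Mom → Mom → Mom → ℝ} {C₁ γ : ℝ}
    (hA : IsCollisionKernel A C₁ γ) {a : ℝ} (ha : 1 ≤ a) (R : Mom ≃ₗᵢ[ℝ] Mom)
    (hR : ∀ p q p' q', A a (R p) (R q) (R p') (R q') = A a p q p' q') {u g : L12}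
    (hg : ∀ᵐ p : Mom, g p = 1 / energy a p * collision A a u u p) :
    ‖g - rotateL12 R g‖ₑ ≤ 2 * (ENNReal.ofReal C₁ * (ENNReal.ofReal (a ^ 3) * sphereMeasure univ * 2)
        * (‖u‖ₑ + ‖u‖ₑ)) * ‖u - rotateL12 R u‖ₑ := by
  have hu : Measurable u := (Lp.stronglyMeasurable u).measurable
  have hv : Measurable (u ∘ R) := hu.comp R.continuous.measurable
  have hvu : ∫⁻ p, ‖(u ∘ R) p‖ₑ = ∫⁻ p, ‖u p‖ₑ := lintegral_comp_isometry R fun p => ‖u p‖ₑ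
  have hui : ∫⁻ p, ‖u p‖ₑ ≠ ⊤ := ne_top_of_le_ne_top enorm_ne_top (L12.lintegral_enorm_le u)
  have hsub : ∫⁻ p, ‖u p - (u ∘ R) p‖ₑ ≤ ‖u - rotateL12 R u‖ₑ := by
    refine le_of_eq_of_le (lintegral_congr_ae ?_) (L12.lintegral_enorm_le _)
    filter_upwards [ae_weightedMeasure_iff.1 (Lp.coeFn_sub u (rotateL12 R u)),
      coeFn_rotateL12 R u] with p h1 h2
    rw [h1, Pi.sub_apply, h2, Function.comp_apply]
  have hmain := lintegral_collision_sub_le hA ha hu hv hui (hvu ▸ hui)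
  rw [hvu] at hmain
  calc ‖g - rotateL12 R g‖ₑ
      = ∫⁻ p, ENNReal.ofReal (√(1 + ‖p‖ ^ 2)) * ‖1 / energy a p * collision A a u u p
        - 1 / energy a p * collision A a (u ∘ R) (u ∘ R) p‖ₑ := by
        rw [L12.enorm_eq]
        refine lintegral_congr_ae ?_
        filter_upwards [ae_weightedMeasure_iff.1 (Lp.coeFn_sub g (rotateL12 R g)),
          coeFn_rotateL12 R g, hg, R.measurePreserving.quasiMeasurePreserving.ae hg]
          with p h1 h2 h3 h4
        rw [h1, Pi.sub_apply, h2, h3, h4, energy_isometry, collision_isometry R hR]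
    _ ≤ _ := hmain
    _ ≤ 2 * (ENNReal.ofReal C₁ * (ENNReal.ofReal (a ^ 3) * sphereMeasure univ * 2)
        * (‖u‖ₑ + ‖u‖ₑ) * ‖u - rotateL12 R u‖ₑ) := by
        gcongr
        · exact L12.lintegral_enorm_le u
        · exact L12.lintegral_enorm_le u
    _ = _ := by ring

/-- An integral form of Grönwall's lemma. -/
theorem eq_zero_of_integral_eq_of_norm_le {E : Type*} [NormedAddCommGroup E] [NormedSpace ℝ E]
    {b T K : ℝ} {h D : ℝ → E} (hcont : ContinuousOn h (Icc b (b + T)))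
    (heq : ∀ t ∈ Icc b (b + T), h t = ∫ s in b..t, D s)
    (hD : ∀ s ∈ Icc b (b + T), ‖D s‖ ≤ K * ‖h s‖) :
    ∀ t ∈ Icc b (b + T), h t = 0 := by
  have hnorm : ContinuousOn (fun s => ‖h s‖) (Icc b (b + T)) := hcont.norm
  have hint : ∀ t ∈ Icc b (b + T), IntervalIntegrable (fun s => ‖h s‖) volume b t :=
    fun t ht => (hnorm.mono (Icc_subset_Icc_right ht.2)).intervalIntegrable_of_Icc ht.1
  have hle : ∀ t ∈ Icc b (b + T), ‖h t‖ ≤ K * ∫ s in b..t, ‖h s‖ := by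
    intro t ht
    rw [heq t ht, ← intervalIntegral.integral_const_mul]
    refine intervalIntegral.norm_integral_le_of_norm_le ht.1
      (Filter.Eventually.of_forall fun s hs => ?_) ((hint t ht).const_mul K)
    exact hD s ⟨hs.1.le, hs.2.trans ht.2⟩
  -- The differential Grönwall inequality is applied to the primitive of `‖h‖`, which is
  -- differentiable from the right because `h` is continuous; `h` itself need not be differentiable.
  have hzero : ∀ t ∈ Icc b (b + T), ‖∫ s in b..t, ‖h s‖‖ ≤ gronwallBound 0 K 0 (t - b) := by
    refine norm_le_gronwallBound_of_norm_deriv_right_le (f' := fun s => ‖h s‖) ?_ ?_ (by simp) ?_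
    · rcases le_or_gt 0 T with hT | hT
      · have hb : b ≤ b + T := by linarith
        have := intervalIntegral.continuousOn_primitive_interval'
          (hint _ (right_mem_Icc.2 hb)) left_mem_uIcc
        rwa [uIcc_of_le hb] at this
      · rw [Icc_eq_empty (by linarith)]
        exact continuousOn_empty _
    · intro x hx
      refine intervalIntegral.integral_hasDerivWithinAt_right (hint x (Ico_subset_Icc_self hx))
        ?_ ?_ (t := Ioi x)
      · exact ⟨Icc b (b + T), Filter.mem_of_superset (Ioc_mem_nhdsGT hx.2)
            fun y hy => ⟨hx.1.trans hy.1.le, hy.2⟩,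
          hnorm.aestronglyMeasurable measurableSet_Icc⟩
      · refine (hnorm x (Ico_subset_Icc_self hx)).mono_of_mem_nhdsWithin ?_
        exact Filter.mem_of_superset (Ioc_mem_nhdsGT hx.2) fun y hy => ⟨hx.1.trans hy.1.le, hy.2⟩
    · intro x hx
      have hx' := Ico_subset_Icc_self hx
      rw [norm_norm, add_zero, Real.norm_of_nonneg
        (intervalIntegral.integral_nonneg hx'.1 fun s _ => norm_nonneg _)]
      exact hle x hx'
  intro t ht
  have h1 := hzero t ht
  rw [gronwallBound_ε0_δ0, norm_le_zero_iff] at h1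
  have h2 := hle t ht
  rw [h1, mul_zero, norm_le_zero_iff] at h2
  exact h2

/-- The rotation is a bounded linear map on `L12`, so it commutes with the time integral. As it
fixes the datum, only the integral of `G - R G` remains, and Grönwall's lemma applies. -/
theorem isSO3Invariant_solution {t₀ T : ℝ} (hT : 0 < T) {a : ℝ → ℝ}
    (ha : ContinuousOn a (Icc t₀ (t₀ + T))) (ha_ge : ∀ t ∈ Icc t₀ (t₀ + T), 1 ≤ a t)
    {A : ℝ → Mom → Mom → Mom → Mom → ℝ} {C₁ γ : ℝ} (hA : IsCollisionKernel A C₁ γ)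
    (hA_inv : ∀ t ∈ Icc t₀ (t₀ + T), ∀ M ∈ Matrix.specialOrthogonalGroup (Fin 3) ℝ,
      ∀ p q p' q' : Mom, A (a t) (act M p) (act M q) (act M p') (act M q') = A (a t) p q p' q')
    {f₀ : L12} (hf₀_inv : IsSO3Invariant f₀) {r : ℝ} {f : ℝ → L12}
    (hf : IsBoltzmannSolution A a t₀ T r f₀ f) {t : ℝ} (ht : t ∈ Icc t₀ (t₀ + T)) :
    IsSO3Invariant (f t) := by
  intro M hM
  obtain ⟨R, hR⟩ := exists_isometry_eq_act hM
  obtain ⟨G, hG, hGi, hfG⟩ := hf.integral_eq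
  obtain ⟨α, hα⟩ := (isCompact_Icc.image_of_continuousOn ha).bddAbove
  have hfix : rotateL12 R f₀ = f₀ := by
    refine Lp.ext (ae_weightedMeasure_iff.2 ?_)
    filter_upwards [coeFn_rotateL12 R f₀, hf₀_inv M hM] with p h1 h2
    rw [h1, hR, h2]
  -- A Lipschitz constant uniform in time: `α` bounds `a` on the compact interval, and `r` bounds
  -- the norm of the solution.
  set K : ENNReal := 2 * (ENNReal.ofReal C₁ * (ENNReal.ofReal (α ^ 3) * sphereMeasure univ * 2)
    * (ENNReal.ofReal r + ENNReal.ofReal r)) with hK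
  have hKtop : K ≠ ⊤ := by rw [hK]; finiteness
  have hzero := eq_zero_of_integral_eq_of_norm_le (b := t₀) (T := T) (K := K.toReal)
    (h := fun s => f s - rotateL12 R (f s)) (D := fun s => G s - rotateL12 R (G s))
    (hf.continuousOn.sub ((rotateL12 R).continuous.comp_continuousOn hf.continuousOn)) ?_ ?_ t ht
  · filter_upwards [coeFn_rotateL12 R (f t)] with p hp
    rw [← hR, ← hp, ← sub_eq_zero.1 hzero]
  · intro s hs
    have hGs : IntervalIntegrable G volume t₀ s :=
      hGi.mono_set (by
        rw [uIcc_of_le hs.1, uIcc_of_le (by linarith)]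
        exact Icc_subset_Icc_right hs.2)
    have hs' := hfG (s - t₀) ⟨by linarith [hs.1], by linarith [hs.2]⟩
    rw [add_sub_cancel] at hs'
    have hRG : IntervalIntegrable (fun s => rotateL12 R (G s)) volume t₀ s :=
      ⟨(rotateL12 R).toContinuousLinearMap.integrable_comp hGs.1,
        (rotateL12 R).toContinuousLinearMap.integrable_comp hGs.2⟩
    rw [intervalIntegral.integral_sub hGs hRG, (rotateL12 R).intervalIntegral_comp_comm, hs',
      map_add, hfix]
    abel
  · intro s hs
    have hαs : a s ≤ α := hα ⟨s, hs, rfl⟩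
    have h1 := ha_ge s hs
    have h := enorm_sub_rotateL12_le hA h1 R (fun p q p' q' => by
      simp only [hR]; exact hA_inv s hs M hM p q p' q') (hG s hs)
    have hu : ‖f s‖ₑ ≤ ENNReal.ofReal r := by
      rw [← ofReal_norm]
      exact ENNReal.ofReal_le_ofReal (hf.mem_X s hs).2
    have h' : ‖G s - rotateL12 R (G s)‖ₑ ≤ K * ‖f s - rotateL12 R (f s)‖ₑ := by
      refine h.trans ?_
      rw [hK]
      gcongr
    have := ENNReal.toReal_mono (by finiteness) h'
    simpa only [ENNReal.toReal_mul, toReal_enorm] using this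

end RWBoltzmann

end

/-! ### The proposition -/

open RWBoltzmann
theorem proposition4p1
    (t₀ T : ℝ) (ht₀ : 0 ≤ t₀) (hT : 0 < T)
    (a : ℝ → ℝ) (ha : ContinuousOn a (Icc t₀ (t₀ + T)))
    (ha_ge : ∀ t ∈ Icc t₀ (t₀ + T), 3 / 2 ≤ a t)
    (A : ℝ → Mom → Mom → Mom → Mom → ℝ) (C₁ γ : ℝ) (hC₁ : 0 < C₁) (hγ : 0 < γ)
    (hA : IsCollisionKernel A C₁ γ)
    (hA_inv : ∀ t ∈ Icc t₀ (t₀ + T), ∀ M ∈ Matrix.specialOrthogonalGroup (Fin 3) ℝ,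
      ∀ p q p' q' : Mom, A (a t) (act M p) (act M q) (act M p') (act M q') = A (a t) p q p' q')
    (f₀ : L12) (hf₀ : ∀ᵐ p : Mom, 0 ≤ f₀ p) (hf₀_inv : IsSO3Invariant f₀)
    (r : ℝ) (hr : ‖f₀‖ < r)
    (f : ℝ → L12) (hf : IsBoltzmannSolution A a t₀ T r f₀ f) :
    -- the solution stays invariant
    (∀ t ∈ Icc 0 T, IsSO3Invariant (f (t₀ + t))) ∧
    -- the stress-energy tensor is well defined, diagonal, and isotropic
    (∀ t ∈ Icc t₀ (t₀ + T),
      (∀ α β : Fin 4, Integrable (stressIntegrand (a t) (f t) α β)) ∧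
      stress (a t) (f t) 1 1 = stress (a t) (f t) 2 2 ∧
      stress (a t) (f t) 2 2 = stress (a t) (f t) 3 3 ∧
      (∀ i : Fin 4, i ≠ 0 → stress (a t) (f t) 0 i = 0) ∧
      (∀ i j : Fin 4, i ≠ 0 → j ≠ 0 → i ≠ j → stress (a t) (f t) i j = 0)) ∧
    -- the ten Einstein equations for the Robertson-Walker metric reduce to two
    (∀ (Λ : ℝ) (x : Fin 4 → ℝ), x 0 ∈ Ioo t₀ (t₀ + T) → ContDiffAt ℝ 2 a (x 0) →
      ((∀ α β : Fin 4, EinsteinEq Λ a f x α β) ↔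
        EinsteinEq Λ a f x 0 0 ∧ EinsteinEq Λ a f x 1 1)) := by
  have ha1 : ∀ t ∈ Icc t₀ (t₀ + T), 1 ≤ a t := fun t ht => by linarith [ha_ge t ht]
  have hinv : ∀ t ∈ Icc t₀ (t₀ + T), IsSO3Invariant (f t) := fun t ht =>
    isSO3Invariant_solution hT ha ha1 hA hA_inv hf₀_inv hf ht
  have hoff : ∀ t ∈ Icc t₀ (t₀ + T), ∀ α β : Fin 4, α ≠ β → stress (a t) (f t) α β = 0 :=
    fun t ht α β h => by rw [stress_eq, stressUp_offDiag (hinv t ht) h, mul_zero]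
  have h12 : ∀ t ∈ Icc t₀ (t₀ + T), stress (a t) (f t) 1 1 = stress (a t) (f t) 2 2 :=
    fun t ht => by rw [stress_eq, stress_eq, (stressUp_diag (hinv t ht)).1]; rfl
  have h23 : ∀ t ∈ Icc t₀ (t₀ + T), stress (a t) (f t) 2 2 = stress (a t) (f t) 3 3 :=
    fun t ht => by rw [stress_eq, stress_eq, (stressUp_diag (hinv t ht)).2]; rfl
  refine ⟨fun t ht => hinv _ ⟨by linarith [ht.1], by linarith [ht.2]⟩, fun t ht =>
    ⟨integrable_stressIntegrand (ha1 t ht) (f t), h12 t ht, h23 t ht,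
      fun i hi => hoff t ht 0 i hi.symm, fun i j _ _ hij => hoff t ht i j hij⟩,
    fun Λ x hx _ => ?_⟩
  have hx' := Ioo_subset_Icc_self hx
  exact einsteinEq_iff Λ a f x (h12 _ hx') (h23 _ hx') (hoff _ hx')
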